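/- Let $X$ and $Y$ be Banach spaces over the same scalar field $\mathbb K$ ($\mathbb K=\mathbb R$ or $\mathbb C$), let $k\ge 1$, and let $P:X\to Y$ be a continuous $k$-homogeneous polynomial, i.e. $P(x)=A(x,\dots,x)$ for some continuous $k$-linear map $A:X^k\to Y$. Terminology. A series $\sum x_n$ in a Banach space $X$ is weakly unconditionally Cauchy (w.u.C.) if $\sum_n|\phi(x_n)|<\infty$ for every $\phi\in X^*$, and unconditionally convergent (u.c.) if every subseries converges. A continuous homogeneous polynomial $Q:Z\to Y$ between Banach spaces (in particular, a bounded linear operator) is unconditionally converging if for every w.u.C. series $\sum z_n$ in $Z$ the sequence $\bigl(Q(\sum_{i=1}^n z_i)\bigr)_n$ converges in norm; it is compact if it maps the closed unit ball to a relatively compact set. A sequence $(x_n)\subset X$ is equivalent to the $c_0$-basis if there are constants $c,C>0$ with $c\max_i|a_i|\le\|\sum_{i=1}^n a_ix_i\|\le C\max_i|a_i|$ for all $n$ and all scalars $a_1,\dots,a_n$. Subspaces are closed, and $j_M:M\to X$ denotes the inclusion of a subspace $M$. Operators are bounded and linear, and $a(i)$ is the $i$-th coordinate of $a\in c_0$.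 The following assertions are equivalent: (A) For every w.u.C. series $\sum x_n$ in $X$: if the set $\{P(\sum_{i=1}^\infty a_n(i)x_i)\}_{n\in\mathbb N}$ is relatively weakly compact for every bounded sequence $(a_n)\subset c_0$, then $\sum x_n$ is u.c. (B) For every w.u.C. series $\sum x_n$ in $X$: if the set $\{P(\sum_{i=1}^\infty a_n(i)x_i)\}_{n\in\mathbb N}$ is relatively compact for every bounded sequence $(a_n)\subset c_0$, then $\sum x_n$ is u.c. (C) If a sequence $(x_n)\subset X$ is equivalent to the $c_0$-basis, then there is a bounded sequence $(a_n)\subset c_0$ such that the set $\{P(\sum_{i=1}^\infty a_n(i)x_i)\}_{n\in\mathbb N}$ is not relatively weakly compact. (D) If a sequence $(x_n)\subset X$ is equivalent to the $c_0$-basis, then there is a bounded sequence $(a_n)\subset c_0$ such that the set $\{P(\sum_{i=1}^\infty a_n(i)x_i)\}_{n\in\mathbb N}$ is not relatively compact. (E) For every Banach space $Z$ and every operator $T:Z\to X$, if $P\circ T$ is unconditionally converging, then $T$ is unconditionally converging. (F) For every operator $T:c_0\to X$, if $P\circ T$ is compact, then $T$ is compact. (G) For every subspace $M\subseteq X$ containing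 a subspace isomorphic to $c_0$, the polynomial $P\circ j_M$ is not unconditionally converging. (H) For every subspace $M\subseteq X$ isomorphic to $c_0$, the polynomial $P\circ j_M$ is not compact. -/

import Mathlib

open Filter Topology
open scoped ZeroAtInfty

universe u v w

namespace OrliczPettis

variable (𝕜 : Type) [RCLike 𝕜]
variable {X : Type u} [NormedAddCommGroup X] [NormedSpace 𝕜 X]
variable {Y : Type v} [NormedAddCommGroup Y] [NormedSpace 𝕜 Y]

/-- The Banach space `c₀` of null sequences of scalars with the supremum norm
(`ℕ` carries the discrete topology). -/
abbrev CZero : Type := C₀(ℕ, 𝕜)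

/-- `P : X → Y` is a continuous `k`-homogeneous polynomial: the restriction to the diagonal of a
continuous `k`-linear map. -/
def IsHomogeneousPolynomial (k : ℕ) (P : X → Y) : Prop :=
  ∃ A : ContinuousMultilinearMap 𝕜 (fun _ : Fin k => X) Y, ∀ x, P x = A (fun _ => x)

/-- The formal series `∑ xₙ` is weakly unconditionally Cauchy. -/
def IsWUC (x : ℕ → X) : Prop :=
  ∀ φ : StrongDual 𝕜 X, Summable fun n => ‖φ (x n)‖

/-- The series `∑ xₙ` is unconditionally convergent: every subseries converges. -/
def IsUC (x : ℕ → X) : Prop :=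
  ∀ σ : ℕ → ℕ, StrictMono σ →
    ∃ s : X, Tendsto (fun n => ∑ i ∈ Finset.range n, x (σ i)) atTop (𝓝 s)

/-- `f` (a homogeneous polynomial, or a linear operator) is unconditionally converging: it maps
the partial sums of every w.u.C. series to a convergent sequence. -/
def IsUnconditionallyConverging (f : X → Y) : Prop :=
  ∀ x : ℕ → X, IsWUC 𝕜 x →
    ∃ y : Y, Tendsto (fun n => f (∑ i ∈ Finset.range n, x i)) atTop (𝓝 y)

/-- Relative compactness in the norm topology. -/
def IsRelCompact (S : Set Y) : Prop :=
  IsCompact (closure S)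

/-- Relative compactness in the weak topology. -/
def IsRelWeaklyCompact (S : Set Y) : Prop :=
  IsCompact (closure (toWeakSpace 𝕜 Y '' S))

/-- A polynomial is compact if it maps the closed unit ball to a relatively compact set. -/
def IsCompactPolynomial (P : X → Y) : Prop :=
  IsRelCompact (P '' Metric.closedBall 0 1)

/-- The sequence `(xₙ)` is equivalent to the unit vector basis of `c₀`:
`c max |aᵢ| ≤ ‖∑ aᵢ xᵢ‖ ≤ C max |aᵢ|` for all finite families of scalars
(`Fin n → 𝕜` carries the maximum norm). -/
def IsEquivalentToCZeroBasis (x : ℕ → X) : Prop :=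
  ∃ c C : ℝ, 0 < c ∧ ∀ (n : ℕ) (a : Fin n → 𝕜),
    c * ‖a‖ ≤ ‖∑ i, a i • x i‖ ∧ ‖∑ i, a i • x i‖ ≤ C * ‖a‖

variable {𝕜} in
/-- The set `{P (∑ᵢ aₙ(i) xᵢ) : n ∈ ℕ}` for a sequence `(aₙ)` in `c₀`. It is used only when
`∑ xᵢ` is w.u.C. and `X` is complete; each of these series is then unconditionally convergent. -/
noncomputable def imageSet (P : X → Y) (x : ℕ → X) (a : ℕ → CZero 𝕜) : Set Y :=
  Set.range fun n => P (∑' i, a n i • x i)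

variable (X) in
/-- `X` is isomorphic (linearly homeomorphic) to `c₀`. -/
def IsIsomorphicToCZero : Prop :=
  Nonempty (X ≃L[𝕜] CZero 𝕜)

variable (X) in
/-- `X` contains a copy of `c₀`. -/
def ContainsCZero : Prop :=
  ∃ N : Submodule 𝕜 X, IsIsomorphicToCZero 𝕜 N

end OrliczPettis

open OrliczPettis

/-!
Each of the eight assertions says that `P` is compact on no isomorphic copy of `c₀` in `X`.

By the Bessaga–Pełczyński gliding hump, an operator `T` that is not unconditionally converging is an
isomorphism on a copy of `c₀`. If `P ∘ T` is unconditionally converging, then `P` is so on the image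
of that copy. There it is compact, because a bounded sequence in `c₀` has a subsequence asymptotic
to the partial sums of a w.u.C. series.

Conversely, a polynomial `F` taking bounded sequences to relatively weakly compact sets is
unconditionally converging: for a w.u.C. series `∑ yᵢ`, the map `S ↦ F (∑ i ∈ S, yᵢ)` on finite sets
is uniformly continuous for the topology of the Cantor space. This goes by induction on the degree,
through the differences of `F`, which reduce it to continuity at `∅`. For scalar `F`, compare with a
set where the supremum is almost attained. In general, the scalar case provides a weakly continuous
extension of the map to the Cantor space. By Baire's theorem it has small oscillation on some open
set, and a difference transports this to `∅`.
-/

namespace OrliczPettis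

open scoped fwdDiff Pointwise

section PolynomialMaps

variable {X Y Z : Type*} [AddCommGroup X] [AddCommGroup Y] [AddCommGroup Z]

/-- Polynomial maps of degree at most `k` between additive groups, in the sense of Fréchet: all
iterated differences of order `k + 1` vanish. Unlike homogeneous polynomials, they are closed under
differences, which lowers the degree and makes induction possible. -/
def IsPolynomialMap : ℕ → (X → Y) → Prop
  | 0, f => ∀ x y, f x = f y
  | k + 1, f => ∀ h, IsPolynomialMap k (Δ_[h] f)

namespace IsPolynomialMap

variable {k : ℕ}

theorem zero : IsPolynomialMap k (0 : X → Y) := by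
  induction k with
  | zero => exact fun _ _ ↦ rfl
  | succ k ih =>
    intro h
    rwa [show Δ_[h] (0 : X → Y) = 0 from fwdDiff_const h 0]

theorem add {f g : X → Y} (hf : IsPolynomialMap k f) (hg : IsPolynomialMap k g) :
    IsPolynomialMap k (f + g) := by
  induction k generalizing f g with
  | zero => exact fun x y ↦ congrArg₂ (· + ·) (hf x y) (hg x y)
  | succ k ih =>
    intro h
    rw [fwdDiff_add]
    exact ih (hf h) (hg h)

theorem sum {ι : Type*} {f : ι → X → Y} {s : Finset ι} (hf : ∀ i ∈ s, IsPolynomialMap k (f i)) :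
    IsPolynomialMap k (∑ i ∈ s, f i) :=
  Finset.sum_induction f (IsPolynomialMap k) (fun _ _ ↦ add) zero hf

theorem map {f : X → Y} (hf : IsPolynomialMap k f) (g : Y →+ Z) : IsPolynomialMap k (g ∘ f) := by
  induction k generalizing f with
  | zero => exact fun x y ↦ congrArg g (hf x y)
  | succ k ih =>
    intro h
    have hcomm : Δ_[h] (g ∘ f) = g ∘ Δ_[h] f := by
      ext x
      simp [fwdDiff]
    rw [hcomm]
    exact ih (hf h)

end IsPolynomialMap

variable {R ι : Type*} [Semiring R] [Module R X] [Module R Y] [DecidableEq ι]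

theorem fwdDiff_multilinearMap_piecewise (A : MultilinearMap R (fun _ : ι ↦ X) Y) (s : Finset ι)
    (v : ι → X) (h : X) :
    Δ_[h] (fun x ↦ A (s.piecewise (fun _ ↦ x) v)) =
      ∑ t ∈ s.ssubsets, fun x ↦ A (t.piecewise (fun _ ↦ x) (s.piecewise (fun _ ↦ h) v)) := by
  ext x
  have hadd : s.piecewise (fun _ ↦ x + h) v =
      s.piecewise ((fun _ ↦ x) + s.piecewise (fun _ ↦ h) v) (s.piecewise (fun _ ↦ h) v) := by
    ext i
    by_cases hi : i ∈ s <;> simp [hi]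
  have htop : s.piecewise (fun _ ↦ x) v = s.piecewise (fun _ ↦ x) (s.piecewise (fun _ ↦ h) v) := by
    ext i
    by_cases hi : i ∈ s <;> simp [hi]
  rw [fwdDiff, hadd, A.map_piecewise_add, htop, Finset.sum_apply, Finset.ssubsets,
    ← Finset.sum_erase_add _ _ (Finset.mem_powerset_self s), add_sub_cancel_right]

theorem isPolynomialMap_multilinearMap_piecewise (A : MultilinearMap R (fun _ : ι ↦ X) Y) {k : ℕ}
    {s : Finset ι} (hs : s.card ≤ k) (v : ι → X) :
    IsPolynomialMap k fun x ↦ A (s.piecewise (fun _ ↦ x) v) := by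
  induction k generalizing s v with
  | zero =>
    obtain rfl : s = ∅ := Finset.card_eq_zero.1 (Nat.le_zero.1 hs)
    intro x y
    simp
  | succ k ih =>
    intro h
    rw [fwdDiff_multilinearMap_piecewise]
    refine IsPolynomialMap.sum fun t ht ↦ ih ?_ _
    have := Finset.card_lt_card (Finset.mem_ssubsets.1 ht)
    omega

end PolynomialMaps

theorem IsHomogeneousPolynomial.isPolynomialMap {𝕜 : Type} [RCLike 𝕜] {X Y : Type*}
    [NormedAddCommGroup X] [NormedSpace 𝕜 X] [NormedAddCommGroup Y] [NormedSpace 𝕜 Y] {k : ℕ}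
    {P : X → Y} (hP : IsHomogeneousPolynomial 𝕜 k P) : IsPolynomialMap k P := by
  obtain ⟨A, hA⟩ := hP
  have := isPolynomialMap_multilinearMap_piecewise A.toMultilinearMap (Finset.card_fin k).le 0
  simpa [← hA] using this

section TailContinuity

variable {X Y : Type*} [AddCommGroup X] [NormedAddCommGroup Y] {F : X → Y} {y : ℕ → X} {k : ℕ}

/-- Uniform continuity of `S ↦ F (∑ i ∈ S, y i)` on the finite subsets of `ℕ`, for the uniformity
induced by the Cantor space of all subsets of `ℕ`. -/
def IsTailContinuous (F : X → Y) (y : ℕ → X) : Prop :=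
  ∀ ε > 0, ∃ N, ∀ S T : Finset ℕ, (∀ i < N, i ∈ S ↔ i ∈ T) →
    ‖F (∑ i ∈ S, y i) - F (∑ i ∈ T, y i)‖ ≤ ε

/-- Continuity of `S ↦ F (∑ i ∈ S, y i)` at `S = ∅`, for the topology induced by the Cantor space
of all subsets of `ℕ`. -/
def IsTailContinuousAtEmpty (F : X → Y) (y : ℕ → X) : Prop :=
  ∀ ε > 0, ∃ N, ∀ S : Finset ℕ, (∀ i ∈ S, N ≤ i) → ‖F (∑ i ∈ S, y i) - F 0‖ ≤ ε

theorem IsTailContinuous.atEmpty (hF : IsTailContinuous F y) : IsTailContinuousAtEmpty F y := by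
  intro ε hε
  obtain ⟨N, hN⟩ := hF ε hε
  refine ⟨N, fun S hS ↦ ?_⟩
  simpa using hN S ∅ fun i hi ↦ iff_of_false (fun h ↦ hi.not_ge (hS i h)) (Finset.notMem_empty i)

theorem IsTailContinuousAtEmpty.isTailContinuous (hF : IsTailContinuousAtEmpty F y)
    (hΔ : ∀ h, IsTailContinuous (Δ_[h] F) y) : IsTailContinuous F y := by
  intro ε hε
  obtain ⟨n, hn⟩ := hF (ε / 3) (by positivity)
  choose N hN using fun h ↦ hΔ h (ε / 3) (by positivity)
  refine ⟨max n ((Finset.range n).powerset.sup fun A ↦ N (∑ i ∈ A, y i)), fun S T hST ↦ ?_⟩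
  have hinit : {i ∈ T | i < n} = {i ∈ S | i < n} := by
    ext i
    simp only [Finset.mem_filter]
    exact and_congr_left fun hi ↦ (hST i (lt_max_of_lt_left hi)).symm
  set a := ∑ i ∈ S with i < n, y i with ha
  set s := ∑ i ∈ S with ¬ i < n, y i
  set t := ∑ i ∈ T with ¬ i < n, y i
  have hS : ∑ i ∈ S, y i = s + a := by rw [add_comm, Finset.sum_filter_add_sum_filter_not]
  have hT : ∑ i ∈ T, y i = t + a := by
    rw [add_comm, ha, ← hinit, Finset.sum_filter_add_sum_filter_not]
  have hs : ‖F s - F 0‖ ≤ ε / 3 := hn _ (by simp)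
  have ht : ‖F t - F 0‖ ≤ ε / 3 := hn _ (by simp)
  have hst : ‖Δ_[a] F s - Δ_[a] F t‖ ≤ ε / 3 := by
    refine hN a _ _ fun i hi ↦ ?_
    have hmem : {i ∈ S | i < n} ∈ (Finset.range n).powerset := by
      simp [Finset.subset_iff]
    have hle := Finset.le_sup (f := fun A ↦ N (∑ i ∈ A, y i)) hmem
    simp only [Finset.mem_filter, hST i (lt_max_of_lt_right (hi.trans_le hle))]
  calc ‖F (∑ i ∈ S, y i) - F (∑ i ∈ T, y i)‖
      = ‖(Δ_[a] F s - Δ_[a] F t) + ((F s - F 0) - (F t - F 0))‖ := by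
        rw [hS, hT]
        simp only [fwdDiff]
        congr 1
        abel
    _ ≤ ε / 3 + (ε / 3 + ε / 3) := norm_add_le_of_le hst (norm_sub_le_of_le hs ht)
    _ = ε := by ring

/-- The difference `Δ_[∑ i ∈ T, y i] F` transports small oscillation from `T` to `∅`. -/
theorem isTailContinuousAtEmpty_of_small_oscillation (hΔ : ∀ h, IsTailContinuous (Δ_[h] F) y)
    (hF : ∀ ε > 0, ∃ (T : Finset ℕ) (N : ℕ), ∀ S : Finset ℕ, (∀ i ∈ S, N ≤ i) →
      ‖F (∑ i ∈ S, y i + ∑ i ∈ T, y i) - F (∑ i ∈ T, y i)‖ ≤ ε) :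
    IsTailContinuousAtEmpty F y := by
  intro ε hε
  obtain ⟨T, N, hT⟩ := hF (ε / 2) (half_pos hε)
  obtain ⟨N', hN'⟩ := (hΔ (∑ i ∈ T, y i)).atEmpty (ε / 2) (half_pos hε)
  refine ⟨max N N', fun S hS ↦ ?_⟩
  have hosc := hT S fun i hi ↦ (le_max_left _ _).trans (hS i hi)
  have hdiff := hN' S fun i hi ↦ (le_max_right _ _).trans (hS i hi)
  set s := ∑ i ∈ S, y i
  set t := ∑ i ∈ T, y i
  calc ‖F s - F 0‖ = ‖(F (s + t) - F t) - (Δ_[t] F s - Δ_[t] F 0)‖ := by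
        simp only [fwdDiff, zero_add]
        congr 1
        abel
    _ ≤ ε / 2 + ε / 2 := norm_sub_le_of_le hosc hdiff
    _ = ε := add_halves ε

theorem IsPolynomialMap.isTailContinuous_of_forall_atEmpty {p : (X → Y) → Prop}
    (hp : ∀ F h, p F → p (Δ_[h] F))
    (hempty : ∀ k F, IsPolynomialMap k F → p F → (∀ h, IsTailContinuous (Δ_[h] F) y) →
      IsTailContinuousAtEmpty F y)
    (hF : IsPolynomialMap k F) (hpF : p F) : IsTailContinuous F y := by
  induction k generalizing F with
  | zero =>
    intro ε hε
    refine ⟨0, fun S T _ ↦ ?_⟩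
    rw [hF (∑ i ∈ S, y i) (∑ i ∈ T, y i), sub_self, norm_zero]
    exact hε.le
  | succ k ih =>
    have hΔ : ∀ h, IsTailContinuous (Δ_[h] F) y := fun h ↦ ih (hF h) (hp F h hpF)
    exact (hempty _ F hF hpF hΔ).isTailContinuous hΔ

theorem IsTailContinuous.exists_tendsto [CompleteSpace Y] (hF : IsTailContinuous F y) :
    ∃ z, Tendsto (fun n ↦ F (∑ i ∈ Finset.range n, y i)) atTop (𝓝 z) := by
  refine cauchySeq_tendsto_of_complete (Metric.cauchySeq_iff.2 fun ε hε ↦ ?_)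
  obtain ⟨N, hN⟩ := hF (ε / 2) (half_pos hε)
  refine ⟨N, fun m hm n hn ↦ ?_⟩
  rw [dist_eq_norm]
  refine (hN _ _ fun i hi ↦ ?_).trans_lt (half_lt_self hε)
  simp [hi.trans_le hm, hi.trans_le hn]

end TailContinuity

section ScalarValued

variable {X : Type*} [AddCommGroup X] {y : ℕ → X} {k : ℕ}

/-- Comparison of `F` on `S ∪ T` with `F` on `T`, where `T` almost attains the supremum. -/
theorem exists_forall_sub_zero_le_of_bddAbove {F : X → ℝ}
    (hb : BddAbove (Set.range fun S : Finset ℕ ↦ F (∑ i ∈ S, y i)))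
    (hΔ : ∀ h, IsTailContinuous (Δ_[h] F) y) {ε : ℝ} (hε : 0 < ε) :
    ∃ N, ∀ S : Finset ℕ, (∀ i ∈ S, N ≤ i) → F (∑ i ∈ S, y i) - F 0 ≤ ε := by
  obtain ⟨T, hT⟩ := exists_lt_of_lt_ciSup
    (sub_lt_self (⨆ S : Finset ℕ, F (∑ i ∈ S, y i)) (half_pos hε))
  obtain ⟨N, hN⟩ := (hΔ (∑ i ∈ T, y i)).atEmpty (ε / 2) (half_pos hε)
  refine ⟨max N (T.sup id + 1), fun S hS ↦ ?_⟩
  have hdisj : Disjoint S T := by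
    refine Finset.disjoint_left.2 fun i hiS hiT ↦ ?_
    have hle : i ≤ T.sup id := Finset.le_sup (f := id) hiT
    have hlt := (le_max_right _ _).trans (hS i hiS)
    omega
  have hsup := le_ciSup hb (S ∪ T)
  have hdiff := hN S fun i hi ↦ (le_max_left _ _).trans (hS i hi)
  simp only [Finset.sum_union hdisj] at hsup
  simp only [fwdDiff, zero_add, Real.norm_eq_abs, abs_le] at hdiff
  linarith [hdiff.1]

theorem isTailContinuous_neg_iff {Y : Type*} [NormedAddCommGroup Y] {F : X → Y} :
    IsTailContinuous (-F) y ↔ IsTailContinuous F y := by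
  simp only [IsTailContinuous, Pi.neg_apply, neg_sub_neg, norm_sub_rev]

theorem IsPolynomialMap.isTailContinuous_real {F : X → ℝ} (hF : IsPolynomialMap k F)
    (hb : ∀ h, Bornology.IsBounded (Set.range fun S : Finset ℕ ↦ F (h + ∑ i ∈ S, y i))) :
    IsTailContinuous F y := by
  refine hF.isTailContinuous_of_forall_atEmpty
    (p := fun F ↦ ∀ h, Bornology.IsBounded (Set.range fun S : Finset ℕ ↦ F (h + ∑ i ∈ S, y i)))
    (fun F h hb h' ↦ ?_) (fun _ F _ hb hΔ ε hε ↦ ?_) hb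
  · refine ((hb (h' + h)).sub (hb h')).subset (Set.range_subset_iff.2 fun S ↦ ?_)
    rw [fwdDiff, add_right_comm]
    exact Set.sub_mem_sub ⟨S, rfl⟩ ⟨S, rfl⟩
  · have hb₀ : Bornology.IsBounded (Set.range fun S : Finset ℕ ↦ F (∑ i ∈ S, y i)) := by
      simpa using hb 0
    have hΔ' : ∀ h, IsTailContinuous (Δ_[h] (-F)) y := fun h ↦ by
      have hneg : Δ_[h] (-F) = -Δ_[h] F := by
        ext x
        simp [fwdDiff, neg_add_eq_sub]
      rw [hneg, isTailContinuous_neg_iff]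
      exact hΔ h
    obtain ⟨N, hN⟩ := exists_forall_sub_zero_le_of_bddAbove hb₀.bddAbove hΔ hε
    obtain ⟨N', hN'⟩ := exists_forall_sub_zero_le_of_bddAbove (F := -F)
      (by simpa [← Set.neg_range] using hb₀.bddBelow.neg) hΔ' hε
    refine ⟨max N N', fun S hS ↦ abs_le.2 ⟨?_, hN S fun i hi ↦ (le_max_left _ _).trans (hS i hi)⟩⟩
    have := hN' S fun i hi ↦ (le_max_right _ _).trans (hS i hi)
    simp only [Pi.neg_apply] at this
    linarith

theorem norm_le_abs_re_add_abs_im {𝕜 : Type*} [RCLike 𝕜] (z : 𝕜) :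
    ‖z‖ ≤ |RCLike.re z| + |RCLike.im z| := by
  refine le_of_sq_le_sq ?_ (by positivity)
  rw [RCLike.norm_sq_eq_def, ← abs_mul_abs_self (RCLike.re z), ← abs_mul_abs_self (RCLike.im z)]
  nlinarith [mul_nonneg (abs_nonneg (RCLike.re z)) (abs_nonneg (RCLike.im z))]

theorem IsPolynomialMap.isTailContinuous_scalar {𝕜 : Type*} [RCLike 𝕜] {F : X → 𝕜}
    (hF : IsPolynomialMap k F)
    (hb : ∀ h, Bornology.IsBounded (Set.range fun S : Finset ℕ ↦ F (h + ∑ i ∈ S, y i))) :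
    IsTailContinuous F y := by
  have key : ∀ g : 𝕜 →ₗ[ℝ] ℝ, (∀ z, |g z| ≤ ‖z‖) → IsTailContinuous (g ∘ F) y := by
    intro g hg
    refine (hF.map g.toAddMonoidHom).isTailContinuous_real fun h ↦ ?_
    obtain ⟨C, hC⟩ := (hb h).exists_norm_le
    exact isBounded_iff_forall_norm_le.2
      ⟨C, Set.forall_mem_range.2 fun S ↦ (hg _).trans (hC _ ⟨S, rfl⟩)⟩
  intro ε hε
  obtain ⟨N, hN⟩ := key RCLike.reLm RCLike.abs_re_le_norm (ε / 2) (half_pos hε)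
  obtain ⟨N', hN'⟩ := key RCLike.imLm RCLike.abs_im_le_norm (ε / 2) (half_pos hε)
  refine ⟨max N N', fun S T hST ↦ (norm_le_abs_re_add_abs_im _).trans ?_⟩
  have hre := hN S T fun i hi ↦ hST i (lt_max_of_lt_left hi)
  have him := hN' S T fun i hi ↦ hST i (lt_max_of_lt_right hi)
  simp only [Function.comp_apply, ← map_sub, Real.norm_eq_abs, RCLike.reLm_coe,
    RCLike.imLm_coe] at hre him
  linarith

end ScalarValued

section WeakCompactness

variable {𝕜 : Type*} [RCLike 𝕜] {Y : Type*} [NormedAddCommGroup Y] [NormedSpace 𝕜 Y]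

theorem tendsto_toWeakSpace_iff {ι : Type*} {f : ι → Y} {l : Filter ι} {z : Y} :
    Tendsto (fun i ↦ toWeakSpace 𝕜 Y (f i)) l (𝓝 (toWeakSpace 𝕜 Y z)) ↔
      ∀ φ : StrongDual 𝕜 Y, Tendsto (fun i ↦ φ (f i)) l (𝓝 (φ z)) :=
  WeakBilin.tendsto_iff_forall_eval_tendsto (topDualPairing 𝕜 Y).flip fun _ _ h ↦
    (SeparatingDual.eq_iff_forall_dual_eq (R := 𝕜)).2 fun φ ↦ LinearMap.congr_fun h φ

variable (𝕜) in
theorem isClosed_setOf_toWeakSpace_mem {ι : Type*} [TopologicalSpace ι] {f : ι → Y}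
    (hf : Continuous fun i ↦ toWeakSpace 𝕜 Y (f i)) {s : Set Y}
    (hs : letI := NormedSpace.restrictScalars ℝ 𝕜 Y; Convex ℝ s) (hs' : IsClosed s) :
    IsClosed {i | f i ∈ s} := by
  let _ := NormedSpace.restrictScalars ℝ 𝕜 Y
  have _ : IsScalarTower ℝ 𝕜 Y := IsScalarTower.of_algebraMap_smul fun _ _ ↦ rfl
  have hweak : IsClosed (toWeakSpace 𝕜 Y '' s) := by
    rw [← hs'.closure_eq, Convex.toWeakSpace_closure 𝕜 hs]
    exact isClosed_closure
  convert hweak.preimage hf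
  simp [Set.preimage]

variable (𝕜) in
theorem isSeparable_range_of_continuous_toWeakSpace {K : Type*} [TopologicalSpace K]
    [TopologicalSpace.SeparableSpace K] {f : K → Y}
    (hf : Continuous fun a ↦ toWeakSpace 𝕜 Y (f a)) :
    TopologicalSpace.IsSeparable (Set.range f) := by
  obtain ⟨D, hD, hD'⟩ := TopologicalSpace.exists_countable_dense K
  let _ := NormedSpace.restrictScalars ℝ 𝕜 Y
  have hV : IsClosed {a | f a ∈ closure (Submodule.span ℝ (f '' D) : Set Y)} :=
    isClosed_setOf_toWeakSpace_mem 𝕜 hf (Submodule.convex _).closure isClosed_closure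
  have hDV : D ⊆ {a | f a ∈ closure (Submodule.span ℝ (f '' D) : Set Y)} := fun a ha ↦
    subset_closure (Submodule.subset_span ⟨a, ha, rfl⟩)
  exact (hD.image f).isSeparable.span.closure.mono
    (Set.range_subset_iff.2 fun a ↦ closure_minimal hDV hV (hD' a))

variable (𝕜) in
theorem exists_isOpen_norm_sub_le_of_continuous_toWeakSpace {K : Type*} [TopologicalSpace K]
    [BaireSpace K] [TopologicalSpace.SeparableSpace K] [Nonempty K] {f : K → Y}
    (hf : Continuous fun a ↦ toWeakSpace 𝕜 Y (f a)) {ε : ℝ} (hε : 0 < ε) :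
    ∃ U : Set K, IsOpen U ∧ U.Nonempty ∧ ∀ a ∈ U, ∀ b ∈ U, ‖f a - f b‖ ≤ ε := by
  obtain ⟨c, hc, hfc⟩ := isSeparable_range_of_continuous_toWeakSpace 𝕜 hf
  have : Countable c := hc.to_subtype
  let _ := NormedSpace.restrictScalars ℝ 𝕜 Y
  have hclosed : ∀ z : c, IsClosed {a | f a ∈ Metric.closedBall (z : Y) (ε / 2)} := fun z ↦
    isClosed_setOf_toWeakSpace_mem 𝕜 hf (convex_closedBall _ _) Metric.isClosed_closedBall
  have hcover : ⋃ z : c, {a | f a ∈ Metric.closedBall (z : Y) (ε / 2)} = Set.univ := by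
    refine Set.eq_univ_of_forall fun a ↦ Set.mem_iUnion.2 ?_
    obtain ⟨z, hz, hza⟩ := Metric.mem_closure_iff.1 (hfc ⟨a, rfl⟩) (ε / 2) (half_pos hε)
    exact ⟨⟨z, hz⟩, hza.le⟩
  obtain ⟨z, hz⟩ := nonempty_interior_of_iUnion_of_closed hclosed hcover
  refine ⟨_, isOpen_interior, hz, fun a ha b hb ↦ ?_⟩
  have ha' := interior_subset ha
  have hb' := interior_subset hb
  rw [← dist_eq_norm, ← add_halves ε]
  exact (dist_triangle_right _ _ _).trans (add_le_add ha' hb')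

end WeakCompactness

section RelativeWeakCompactness

variable {𝕜 : Type} [RCLike 𝕜] {Y : Type*} [NormedAddCommGroup Y] [NormedSpace 𝕜 Y]

theorem IsRelCompact.isRelWeaklyCompact {s : Set Y} (hs : IsRelCompact s) :
    IsRelWeaklyCompact 𝕜 s :=
  (IsCompact.image hs (toWeakSpaceCLM 𝕜 Y).continuous).closure_of_subset
    (Set.image_mono subset_closure)

theorem IsRelWeaklyCompact.mono {s t : Set Y} (ht : IsRelWeaklyCompact 𝕜 t) (hst : s ⊆ t) :
    IsRelWeaklyCompact 𝕜 s :=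
  IsCompact.closure_of_subset ht ((Set.image_mono hst).trans subset_closure)

theorem IsRelWeaklyCompact.sub {s t : Set Y} (hs : IsRelWeaklyCompact 𝕜 s)
    (ht : IsRelWeaklyCompact 𝕜 t) : IsRelWeaklyCompact 𝕜 (s - t) := by
  refine (IsCompact.add hs (IsCompact.neg ht)).closure_of_subset ?_
  rw [Set.image_sub, ← sub_eq_add_neg]
  exact Set.sub_subset_sub subset_closure subset_closure

theorem IsRelWeaklyCompact.isBounded_image {s : Set Y} (hs : IsRelWeaklyCompact 𝕜 s)
    (φ : StrongDual 𝕜 Y) : Bornology.IsBounded (φ '' s) := by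
  have hφ : Continuous fun z : WeakSpace 𝕜 Y ↦ φ ((toWeakSpace 𝕜 Y).symm z) :=
    WeakBilin.eval_continuous (topDualPairing 𝕜 Y).flip φ
  refine (IsCompact.image hs hφ).isBounded.subset ?_
  rintro _ ⟨z, hz, rfl⟩
  exact ⟨toWeakSpace 𝕜 Y z, subset_closure ⟨z, hz, rfl⟩, by simp⟩

theorem IsRelWeaklyCompact.exists_tendsto_of_forall_cauchy {ι : Type*} {f : ι → Y}
    (hf : IsRelWeaklyCompact 𝕜 (Set.range f)) {l : Filter ι} [l.NeBot]
    (hl : ∀ φ : StrongDual 𝕜 Y, Cauchy (l.map fun i ↦ φ (f i))) :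
    ∃ z, Tendsto (fun i ↦ toWeakSpace 𝕜 Y (f i)) l (𝓝 z) := by
  obtain ⟨z, -, hz⟩ := isCompact_iff_ultrafilter_le_nhds'.1 hf
    ((Ultrafilter.of l).map fun i ↦ toWeakSpace 𝕜 Y (f i))
    (mem_map.2 (univ_mem' fun i ↦ subset_closure ⟨f i, ⟨i, rfl⟩, rfl⟩))
  obtain ⟨y, rfl⟩ := (toWeakSpace 𝕜 Y).surjective z
  refine ⟨toWeakSpace 𝕜 Y y, tendsto_toWeakSpace_iff.2 fun φ ↦ le_nhds_of_cauchy_adhp (hl φ) ?_⟩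
  have hU : Tendsto (fun i ↦ φ (f i)) (Ultrafilter.of l) (𝓝 (φ y)) :=
    tendsto_toWeakSpace_iff.1 hz φ
  exact ClusterPt.mono (hU.mapClusterPt) (map_mono (Ultrafilter.of_le l))

end RelativeWeakCompactness

section CantorSpace

/-- The finite subsets of `ℕ` as points of the Cantor space. -/
def cantorPoint (S : Finset ℕ) : ℕ → Bool := fun i ↦ decide (i ∈ S)

theorem denseRange_cantorPoint : DenseRange cantorPoint := by
  refine fun a ↦ mem_closure_of_tendsto
    (f := fun n ↦ cantorPoint {i ∈ Finset.range n | a i = true}) (b := atTop)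
    (tendsto_pi_nhds.2 fun i ↦ tendsto_nhds_of_eventually_eq ?_)
    (Eventually.of_forall fun n ↦ ⟨_, rfl⟩)
  filter_upwards [eventually_gt_atTop i] with n hn
  simp [cantorPoint, hn]

theorem comap_cantorPoint_neBot (a : ℕ → Bool) : (comap cantorPoint (𝓝 a)).NeBot :=
  comap_neBot fun _ ht ↦ (denseRange_cantorPoint.exists_mem_open isOpen_interior
    ⟨a, mem_interior_iff_mem_nhds.2 ht⟩).imp fun _ h ↦ interior_subset h

theorem exists_cylinder_subset_of_mem_nhds {a : ℕ → Bool} {s : Set (ℕ → Bool)} (hs : s ∈ 𝓝 a) :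
    ∃ N, PiNat.cylinder a N ⊆ s := by
  obtain ⟨_, ⟨b, N, rfl⟩, hab, hb⟩ :=
    (PiNat.isTopologicalBasis_cylinders fun _ ↦ Bool).mem_nhds_iff.1 hs
  exact ⟨N, (PiNat.mem_cylinder_iff_eq.1 hab).trans_subset hb⟩

variable {X Y : Type*} [AddCommGroup X] [NormedAddCommGroup Y]

theorem IsTailContinuous.cauchy_map_comap_cantorPoint {F : X → Y} {y : ℕ → X}
    (hF : IsTailContinuous F y) (a : ℕ → Bool) :
    Cauchy ((comap cantorPoint (𝓝 a)).map fun S ↦ F (∑ i ∈ S, y i)) := by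
  have := comap_cantorPoint_neBot a
  refine Metric.cauchy_iff.2 ⟨inferInstance, fun ε hε ↦ ?_⟩
  obtain ⟨N, hN⟩ := hF (ε / 2) (half_pos hε)
  refine ⟨_, image_mem_map (preimage_mem_comap
    ((PiNat.isOpen_cylinder _ a N).mem_nhds (PiNat.self_mem_cylinder a N))), ?_⟩
  rintro _ ⟨S, hS, rfl⟩ _ ⟨T, hT, rfl⟩
  rw [dist_eq_norm]
  refine (hN S T fun i hi ↦ ?_).trans_lt (half_lt_self hε)
  simpa [cantorPoint] using (hS i hi).trans (hT i hi).symm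

variable {𝕜 : Type} [RCLike 𝕜] [NormedSpace 𝕜 Y] {F : X → Y} {y : ℕ → X}

theorem exists_weakly_continuous_extension
    (hφ : ∀ φ : StrongDual 𝕜 Y, IsTailContinuous (φ ∘ F) y)
    (hK : IsRelWeaklyCompact 𝕜 (Set.range fun S : Finset ℕ ↦ F (∑ i ∈ S, y i))) :
    ∃ g : (ℕ → Bool) → Y, Continuous (fun a ↦ toWeakSpace 𝕜 Y (g a)) ∧
      ∀ S, g (cantorPoint S) = F (∑ i ∈ S, y i) := by
  have hlim : ∀ a, ∃ z, Tendsto (fun S : Finset ℕ ↦ toWeakSpace 𝕜 Y (F (∑ i ∈ S, y i)))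
      (comap cantorPoint (𝓝 a)) (𝓝 z) := fun a ↦ by
    have := comap_cantorPoint_neBot a
    exact hK.exists_tendsto_of_forall_cauchy fun φ ↦ (hφ φ).cauchy_map_comap_cantorPoint a
  let _ : TopologicalSpace (Finset ℕ) := .induced cantorPoint inferInstance
  have hdense : IsDenseInducing cantorPoint := ⟨⟨rfl⟩, denseRange_cantorPoint⟩
  let f (S : Finset ℕ) : WeakSpace 𝕜 Y := toWeakSpace 𝕜 Y (F (∑ i ∈ S, y i))
  refine ⟨fun a ↦ (toWeakSpace 𝕜 Y).symm (hdense.extend f a), ?_, fun S ↦ ?_⟩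
  · simpa using hdense.continuous_extend hlim
  · exact (congrArg _ (hdense.extend_eq' hlim S)).trans (LinearEquiv.symm_apply_apply _ _)

theorem exists_small_oscillation_of_isRelWeaklyCompact
    (hφ : ∀ φ : StrongDual 𝕜 Y, IsTailContinuous (φ ∘ F) y)
    (hK : IsRelWeaklyCompact 𝕜 (Set.range fun S : Finset ℕ ↦ F (∑ i ∈ S, y i))) {ε : ℝ}
    (hε : 0 < ε) :
    ∃ (T : Finset ℕ) (N : ℕ), ∀ S : Finset ℕ, (∀ i ∈ S, N ≤ i) →
      ‖F (∑ i ∈ S, y i + ∑ i ∈ T, y i) - F (∑ i ∈ T, y i)‖ ≤ ε := by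
  obtain ⟨g, hg, hgF⟩ := exists_weakly_continuous_extension hφ hK
  obtain ⟨U, hU, hU', hosc⟩ := exists_isOpen_norm_sub_le_of_continuous_toWeakSpace 𝕜 hg hε
  obtain ⟨T, hT⟩ := denseRange_cantorPoint.exists_mem_open hU hU'
  obtain ⟨N, hN⟩ := exists_cylinder_subset_of_mem_nhds (hU.mem_nhds hT)
  refine ⟨T, max N (T.sup id + 1), fun S hS ↦ ?_⟩
  have hdisj : Disjoint S T := by
    refine Finset.disjoint_left.2 fun i hiS hiT ↦ ?_
    have hle : i ≤ T.sup id := Finset.le_sup (f := id) hiT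
    have hlt := (le_max_right _ _).trans (hS i hiS)
    omega
  have hST : cantorPoint (S ∪ T) ∈ U := by
    refine hN fun i hi ↦ ?_
    have hiS : i ∉ S := fun h ↦ hi.not_ge ((le_max_left _ _).trans (hS i h))
    simp [cantorPoint, hiS]
  simpa only [hgF, Finset.sum_union hdisj] using hosc _ hST _ hT

theorem IsPolynomialMap.isTailContinuous {k : ℕ} (hF : IsPolynomialMap k F)
    (hK : ∀ h, IsRelWeaklyCompact 𝕜 (Set.range fun S : Finset ℕ ↦ F (h + ∑ i ∈ S, y i))) :
    IsTailContinuous F y := by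
  refine hF.isTailContinuous_of_forall_atEmpty
    (p := fun F ↦ ∀ h, IsRelWeaklyCompact 𝕜 (Set.range fun S : Finset ℕ ↦ F (h + ∑ i ∈ S, y i)))
    (fun F h hK h' ↦ ?_) (fun k F hF hK hΔ ↦ ?_) hK
  · refine ((hK (h' + h)).sub (hK h')).mono (Set.range_subset_iff.2 fun S ↦ ?_)
    rw [fwdDiff, add_right_comm]
    exact Set.sub_mem_sub ⟨S, rfl⟩ ⟨S, rfl⟩
  · refine isTailContinuousAtEmpty_of_small_oscillation hΔ fun ε hε ↦
      exists_small_oscillation_of_isRelWeaklyCompact (fun φ ↦ ?_) (by simpa using hK 0) hε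
    refine (hF.map (φ : Y →+ 𝕜)).isTailContinuous_scalar fun h ↦ ?_
    have := (hK h).isBounded_image φ
    rwa [← Set.range_comp] at this

end CantorSpace

section WUC

variable {𝕜 : Type} [RCLike 𝕜] {X Z : Type*} [NormedAddCommGroup X] [NormedSpace 𝕜 X]
  [NormedAddCommGroup Z] [NormedSpace 𝕜 Z] {x : ℕ → X}

namespace IsWUC

theorem map (hx : IsWUC 𝕜 x) (T : X →L[𝕜] Z) : IsWUC 𝕜 (T ∘ x) :=
  fun φ ↦ hx (φ.comp T)

theorem add {y : ℕ → X} (hx : IsWUC 𝕜 x) (hy : IsWUC 𝕜 y) : IsWUC 𝕜 fun n ↦ x n + y n :=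
  fun φ ↦ .of_nonneg_of_le (fun _ ↦ norm_nonneg _)
    (fun _ ↦ (congrArg norm (map_add φ _ _)).trans_le (norm_add_le _ _)) ((hx φ).add (hy φ))

theorem comp_injective (hx : IsWUC 𝕜 x) {f : ℕ → ℕ} (hf : f.Injective) : IsWUC 𝕜 (x ∘ f) :=
  fun φ ↦ (hx φ).comp_injective hf

theorem of_forall_norm_sum_range_le {M : ℝ}
    (h : ∀ (n : ℕ) (a : ℕ → 𝕜), (∀ i, ‖a i‖ ≤ 1) → ‖∑ i ∈ Finset.range n, a i • x i‖ ≤ M) :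
    IsWUC 𝕜 x := by
  intro φ
  choose a ha haφ using fun i ↦ RCLike.exists_norm_eq_mul_self (φ (x i))
  refine summable_of_sum_range_le (c := ‖φ‖ * M) (fun _ ↦ norm_nonneg _) fun n ↦ ?_
  have hsum : ((∑ i ∈ Finset.range n, ‖φ (x i)‖ : ℝ) : 𝕜) =
      φ (∑ i ∈ Finset.range n, a i • x i) := by
    simp only [haφ, map_sum, map_smul, smul_eq_mul]
  rw [← RCLike.norm_of_nonneg (K := 𝕜) (Finset.sum_nonneg fun i _ ↦ norm_nonneg (φ (x i))), hsum]
  exact φ.le_opNorm_of_le (h n a fun i ↦ (ha i).le)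

theorem exists_forall_norm_sum_smul_le_of_norm_le_one (hx : IsWUC 𝕜 x) :
    ∃ M, ∀ (S : Finset ℕ) (a : ℕ → 𝕜), (∀ i ∈ S, ‖a i‖ ≤ 1) → ‖∑ i ∈ S, a i • x i‖ ≤ M := by
  let ι := {p : Finset ℕ × (ℕ → 𝕜) // ∀ i ∈ p.1, ‖p.2 i‖ ≤ 1}
  let v (p : ι) : X := ∑ i ∈ p.1.1, p.1.2 i • x i
  have hv : ∀ (φ : StrongDual 𝕜 X) (p : ι), ‖φ (v p)‖ ≤ ∑' i, ‖φ (x i)‖ := fun φ p ↦ by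
    calc ‖φ (v p)‖ ≤ ∑ i ∈ p.1.1, ‖φ (x i)‖ := by
          simp only [v, map_sum, map_smul]
          refine norm_sum_le_of_le _ fun i hi ↦ ?_
          rw [norm_smul]
          exact mul_le_of_le_one_left (norm_nonneg _) (p.2 i hi)
      _ ≤ ∑' i, ‖φ (x i)‖ := (hx φ).sum_le_tsum _ fun _ _ ↦ norm_nonneg _
  obtain ⟨M, hM⟩ := banach_steinhaus (g := fun p ↦ NormedSpace.inclusionInDoubleDual 𝕜 X (v p))
    fun φ ↦ ⟨_, hv φ⟩
  refine ⟨M, fun S a ha ↦ ?_⟩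
  rw [← (NormedSpace.inclusionInDoubleDualLi 𝕜).norm_map]
  exact hM ⟨(S, a), ha⟩

theorem exists_forall_norm_sum_smul_le (hx : IsWUC 𝕜 x) :
    ∃ M, 0 ≤ M ∧ ∀ (S : Finset ℕ) (a : ℕ → 𝕜) (r : ℝ), 0 ≤ r → (∀ i ∈ S, ‖a i‖ ≤ r) →
      ‖∑ i ∈ S, a i • x i‖ ≤ M * r := by
  obtain ⟨M, hM⟩ := hx.exists_forall_norm_sum_smul_le_of_norm_le_one
  refine ⟨M, (norm_nonneg _).trans (hM ∅ 0 (by simp)), fun S a r hr ha ↦ ?_⟩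
  obtain rfl | hr := hr.eq_or_lt
  · rw [Finset.sum_eq_zero fun i hi ↦ by rw [norm_le_zero_iff.1 (ha i hi), zero_smul]]
    simp
  have hr' : ‖(r : 𝕜)‖ = r := RCLike.norm_of_nonneg hr.le
  have hunit := hM S (fun i ↦ (r : 𝕜)⁻¹ • a i) fun i hi ↦ by
    rw [norm_smul, norm_inv, hr', inv_mul_le_iff₀ hr, mul_one]
    exact ha i hi
  simp only [smul_assoc, ← Finset.smul_sum] at hunit
  rwa [norm_smul, norm_inv, hr', inv_mul_le_iff₀ hr, mul_comm] at hunit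

theorem isBounded_range_sum (hx : IsWUC 𝕜 x) :
    Bornology.IsBounded (Set.range fun S : Finset ℕ ↦ ∑ i ∈ S, x i) := by
  obtain ⟨M, -, hM⟩ := hx.exists_forall_norm_sum_smul_le
  refine isBounded_iff_forall_norm_le.2 ⟨M * 1, Set.forall_mem_range.2 fun S ↦ ?_⟩
  simpa using hM S (fun _ ↦ 1) 1 zero_le_one (by simp)

theorem sum_blocks (hx : IsWUC 𝕜 x) {B : ℕ → Finset ℕ}
    (hB : Pairwise (Function.onFun Disjoint B)) : IsWUC 𝕜 fun m ↦ ∑ i ∈ B m, x i := by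
  intro φ
  refine summable_of_sum_range_le (c := ∑' i, ‖φ (x i)‖) (fun _ ↦ norm_nonneg _) fun n ↦ ?_
  calc ∑ m ∈ Finset.range n, ‖φ (∑ i ∈ B m, x i)‖
      ≤ ∑ m ∈ Finset.range n, ∑ i ∈ B m, ‖φ (x i)‖ :=
        Finset.sum_le_sum fun m _ ↦ (congrArg _ (map_sum φ _ _)).trans_le (norm_sum_le _ _)
    _ = ∑ i ∈ (Finset.range n).biUnion B, ‖φ (x i)‖ :=
        (Finset.sum_biUnion fun i _ j _ hij ↦ hB hij).symm
    _ ≤ ∑' i, ‖φ (x i)‖ := (hx φ).sum_le_tsum _ fun _ _ ↦ norm_nonneg _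

end IsWUC

theorem IsUC.tendsto_zero (hx : IsUC x) : Tendsto x atTop (𝓝 0) := by
  obtain ⟨s, hs⟩ := hx id strictMono_id
  simpa [Finset.sum_range_succ] using ((tendsto_add_atTop_iff_nat 1).2 hs).sub hs

theorem IsUnconditionallyConverging.comp {Y : Type*} [NormedAddCommGroup Y] {P : Z → Y}
    (hP : IsUnconditionallyConverging 𝕜 P) (T : X →L[𝕜] Z) :
    IsUnconditionallyConverging 𝕜 (P ∘ T) :=
  fun x hx ↦ by simpa using hP _ (hx.map T)

theorem IsUnconditionallyConverging.isUC {T : X →L[𝕜] Z} (hT : IsUnconditionallyConverging 𝕜 T)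
    (hx : IsWUC 𝕜 x) : IsUC (T ∘ x) :=
  fun _ hσ ↦ by
    simpa only [map_sum, Function.comp_apply] using hT _ (hx.comp_injective hσ.injective)

end WUC

section HomogeneousPolynomials

variable {𝕜 : Type} [RCLike 𝕜] {W X Y : Type*} [NormedAddCommGroup W] [NormedSpace 𝕜 W]
  [NormedAddCommGroup X] [NormedSpace 𝕜 X] [NormedAddCommGroup Y] [NormedSpace 𝕜 Y]
  {k : ℕ} {P : X → Y}

theorem isHomogeneousPolynomial_one (T : X →L[𝕜] Y) : IsHomogeneousPolynomial 𝕜 1 T :=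
  ⟨T.compContinuousMultilinearMap (ContinuousMultilinearMap.ofSubsingleton 𝕜 X X (0 : Fin 1)
    (ContinuousLinearMap.id 𝕜 X)), fun _ ↦ rfl⟩

namespace IsHomogeneousPolynomial

theorem comp (hP : IsHomogeneousPolynomial 𝕜 k P) (T : W →L[𝕜] X) :
    IsHomogeneousPolynomial 𝕜 k (P ∘ T) := by
  obtain ⟨A, hA⟩ := hP
  exact ⟨A.compContinuousLinearMap fun _ ↦ T, fun x ↦ hA (T x)⟩

theorem map_smul (hP : IsHomogeneousPolynomial 𝕜 k P) (c : 𝕜) (x : X) :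
    P (c • x) = c ^ k • P x := by
  obtain ⟨A, hA⟩ := hP
  simpa [hA] using A.map_smul_univ (fun _ ↦ c) fun _ ↦ x

theorem exists_forall_norm_sub_le (hP : IsHomogeneousPolynomial 𝕜 k P) (R : ℝ) :
    ∃ C, ∀ x y, ‖x‖ ≤ R → ‖y‖ ≤ R → ‖P x - P y‖ ≤ C * ‖x - y‖ := by
  obtain ⟨A, hA⟩ := hP
  refine ⟨‖A‖ * k * R ^ (k - 1), fun x y hx hy ↦ ?_⟩
  have hR : 0 ≤ R := (norm_nonneg x).trans hx
  have hconst : ∀ z : X, ‖fun _ : Fin k ↦ z‖ ≤ ‖z‖ := fun z ↦ pi_norm_const_le z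
  calc ‖P x - P y‖ = ‖A (fun _ ↦ x) - A fun _ ↦ y‖ := by rw [hA, hA]
    _ ≤ ‖A‖ * k * max ‖fun _ : Fin k ↦ x‖ ‖fun _ : Fin k ↦ y‖ ^ (k - 1) *
        ‖(fun _ : Fin k ↦ x) - fun _ ↦ y‖ := by
      simpa only [Fintype.card_fin] using A.norm_image_sub_le _ _
    _ ≤ ‖A‖ * k * R ^ (k - 1) * ‖x - y‖ := by
      gcongr
      exacts [max_le ((hconst x).trans hx) ((hconst y).trans hy), hconst (x - y)]

end IsHomogeneousPolynomial

end HomogeneousPolynomials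

section CompactMaps

variable {𝕜 : Type} [RCLike 𝕜] {W X Y : Type*} [NormedAddCommGroup W] [NormedAddCommGroup X]
  [NormedAddCommGroup Y]

variable (𝕜) in
/-- `F` maps bounded sequences to relatively weakly compact sets. -/
def MapsBoundedToRelWeaklyCompact [NormedSpace 𝕜 Y] (F : W → Y) : Prop :=
  ∀ w : ℕ → W, Bornology.IsBounded (Set.range w) → IsRelWeaklyCompact 𝕜 (Set.range (F ∘ w))

/-- `F` maps bounded sequences to relatively compact sets. -/
def MapsBoundedToRelCompact (F : W → Y) : Prop :=
  ∀ w : ℕ → W, Bornology.IsBounded (Set.range w) → IsRelCompact (Set.range (F ∘ w))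

theorem MapsBoundedToRelCompact.mapsBoundedToRelWeaklyCompact [NormedSpace 𝕜 Y] {F : W → Y}
    (hF : MapsBoundedToRelCompact F) : MapsBoundedToRelWeaklyCompact 𝕜 F :=
  fun w hw ↦ (hF w hw).isRelWeaklyCompact

theorem isRelCompact_of_forall_exists_tendsto {S : Set Y}
    (h : ∀ u : ℕ → Y, (∀ n, u n ∈ S) →
      ∃ (y : Y) (f : ℕ → ℕ), StrictMono f ∧ Tendsto (u ∘ f) atTop (𝓝 y)) :
    IsRelCompact S := by
  refine IsSeqCompact.isCompact fun u hu ↦ ?_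
  choose v hv huv using fun n : ℕ ↦
    Metric.mem_closure_iff.1 (hu n) (1 / ((n : ℝ) + 1)) (by positivity)
  obtain ⟨y, f, hf, hy⟩ := h v hv
  refine ⟨y, mem_closure_of_tendsto hy (Eventually.of_forall fun n ↦ hv _), f, hf,
    hy.congr_dist ?_⟩
  refine squeeze_zero (fun _ ↦ dist_nonneg) (fun n ↦ ?_)
    (tendsto_one_div_add_atTop_nhds_zero_nat.comp hf.tendsto_atTop)
  rw [dist_comm]
  exact (huv (f n)).le

theorem MapsBoundedToRelCompact.isCompactPolynomial {F : W → Y}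
    (hF : MapsBoundedToRelCompact F) : IsCompactPolynomial F := by
  refine isRelCompact_of_forall_exists_tendsto fun u hu ↦ ?_
  choose w hw hwu using hu
  have hbdd : Bornology.IsBounded (Set.range w) :=
    Metric.isBounded_closedBall.subset (Set.range_subset_iff.2 hw)
  obtain rfl : F ∘ w = u := funext hwu
  obtain ⟨y, -, f, hf, hy⟩ := (hF w hbdd).isSeqCompact fun n ↦ subset_closure (Set.mem_range_self n)
  exact ⟨y, f, hf, hy⟩

variable [NormedSpace 𝕜 W] [NormedSpace 𝕜 X] {k : ℕ} {F : W → Y}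

theorem MapsBoundedToRelCompact.comp (hF : MapsBoundedToRelCompact F) (T : X →L[𝕜] W) :
    MapsBoundedToRelCompact (F ∘ T) := fun w hw ↦
  hF (T ∘ w) (Set.range_comp T w ▸ T.lipschitz.isBounded_image hw)

theorem isCompactOperator_iff_isCompactPolynomial (T : W →L[𝕜] X) :
    IsCompactOperator T ↔ IsCompactPolynomial T :=
  isCompactOperator_iff_isCompact_closure_image_closedBall (T : W →ₗ[𝕜] X) one_pos

variable [NormedSpace 𝕜 Y]

theorem IsHomogeneousPolynomial.isCompactPolynomial_iff (hk : IsHomogeneousPolynomial 𝕜 k F) :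
    IsCompactPolynomial F ↔ MapsBoundedToRelCompact F := by
  refine ⟨fun hF w hw ↦ ?_, MapsBoundedToRelCompact.isCompactPolynomial⟩
  obtain ⟨R, hR0, hR⟩ := hw.exists_pos_norm_le
  have hcompact : IsCompact ((fun z ↦ (R : 𝕜) ^ k • z) '' closure (F '' Metric.closedBall 0 1)) :=
    IsCompact.image hF (continuous_const_smul _)
  refine hcompact.closure_of_subset (Set.range_subset_iff.2 fun n ↦ ?_)
  have hR' : (R : 𝕜) ≠ 0 := RCLike.ofReal_ne_zero.2 hR0.ne'
  refine ⟨F ((R : 𝕜)⁻¹ • w n), subset_closure ⟨_, ?_, rfl⟩, ?_⟩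
  · rw [mem_closedBall_zero_iff, norm_smul, norm_inv, RCLike.norm_of_nonneg hR0.le,
      inv_mul_le_iff₀ hR0, mul_one]
    exact hR _ ⟨n, rfl⟩
  · simp only [← hk.map_smul, smul_inv_smul₀ hR', Function.comp_apply]

theorem IsHomogeneousPolynomial.isUnconditionallyConverging [CompleteSpace Y]
    (hk : IsHomogeneousPolynomial 𝕜 k F) (hF : MapsBoundedToRelWeaklyCompact 𝕜 F) :
    IsUnconditionallyConverging 𝕜 F := by
  intro y hy
  refine (hk.isPolynomialMap.isTailContinuous (𝕜 := 𝕜) fun h ↦ ?_).exists_tendsto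
  let e := (Denumerable.eqv (Finset ℕ)).symm
  have hbdd : Bornology.IsBounded (Set.range fun n ↦ h + ∑ i ∈ e n, y i) := by
    refine (hy.isBounded_range_sum.vadd h).subset (Set.range_subset_iff.2 fun n ↦ ?_)
    exact Set.vadd_mem_vadd_set ⟨e n, rfl⟩
  rw [← e.surjective.range_comp]
  exact hF _ hbdd

end CompactMaps

section Subsequences

theorem exists_strictMono_forall_lt_of_eventually {l : Filter ℕ} [l.NeBot] (hl : l ≤ atTop)
    {p : ℕ → Prop} {r : ℕ → ℕ → Prop} (hp : ∀ᶠ n in l, p n) (hr : ∀ m, ∀ᶠ n in l, r m n) :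
    ∃ f : ℕ → ℕ, StrictMono f ∧ (∀ n, p (f n)) ∧ ∀ m n, m < n → r (f m) (f n) := by
  obtain ⟨f, hf, hr⟩ := exists_seq_of_forall_finset_exists p (fun m n ↦ m < n ∧ r m n)
    fun s _ ↦ (hp.and ((eventually_all_finset s).2 fun m _ ↦
      ((eventually_gt_atTop m).filter_mono hl).and (hr m))).exists
  exact ⟨f, fun m n h ↦ (hr m n h).1, hf, fun m n h ↦ (hr m n h).2⟩

theorem eventually_forall_sum_le_of_summable {g : ℕ → ℝ} (hg : Summable g) {δ : ℝ} (hδ : 0 < δ) :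
    ∀ᶠ N in atTop, ∀ s : Finset ℕ, (∀ i ∈ s, N ≤ i) → ∑ i ∈ s, g i ≤ δ := by
  obtain ⟨t, ht⟩ := summable_iff_vanishing_norm.1 hg δ hδ
  obtain ⟨N₀, hN₀⟩ := t.exists_nat_subset_range
  filter_upwards [eventually_ge_atTop N₀] with N hN s hs
  refine (le_abs_self _).trans (ht s (Finset.disjoint_left.2 fun i hi hit ↦ ?_)).le
  exact ((Finset.mem_range.1 (hN₀ hit)).trans_le hN).not_ge (hs i hi)

/-- Gliding hump: along the subsequence, null columns control the entries before the diagonal and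
summable rows those after it. -/
theorem exists_strictMono_forall_sum_le {l : Filter ℕ} [l.NeBot] (hl : l ≤ atTop)
    {m : ℕ → ℕ → ℝ} (hrow : ∀ j, Summable (m j)) (hcol : ∀ i, Tendsto (fun j ↦ m j i) l (𝓝 0))
    {p : ℕ → Prop} (hp : ∀ᶠ j in l, p j) {δ : ℝ} (hδ : 0 < δ) :
    ∃ f : ℕ → ℕ, StrictMono f ∧ (∀ n, p (f n)) ∧
      ∀ (n : ℕ) (s : Finset ℕ), n ∉ s → ∑ i ∈ s, m (f n) (f i) ≤ δ := by
  obtain ⟨w, hw, c, hwc, hc⟩ := posSumOfEncodable (half_pos hδ) ℕ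
  obtain ⟨f, hf, hpf, hr⟩ := exists_strictMono_forall_lt_of_eventually hl hp fun i ↦
    ((hcol i).eventually (eventually_le_nhds (hw i))).and
      (hl (eventually_forall_sum_le_of_summable (hrow i) (half_pos hδ)))
  refine ⟨f, hf, hpf, fun n s hn ↦ ?_⟩
  let F : ℕ ↪ ℕ := ⟨f, hf.injective⟩
  have hlow : ∑ i ∈ s with i < n, m (f n) (f i) ≤ δ / 2 := by
    calc ∑ i ∈ s with i < n, m (f n) (f i) ≤ ∑ i ∈ s with i < n, w (f i) :=
          Finset.sum_le_sum fun i hi ↦ (hr i n (Finset.mem_filter.1 hi).2).1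
      _ = ∑ i ∈ Finset.map F {i ∈ s | i < n}, w i := (Finset.sum_map _ F w).symm
      _ ≤ δ / 2 := (sum_le_hasSum _ (fun i _ ↦ (hw i).le) hwc).trans hc
  have hhigh : ∑ i ∈ s with ¬ i < n, m (f n) (f i) ≤ δ / 2 := by
    refine (Finset.sum_map _ F (m (f n))).symm.trans_le
      ((hr n (n + 1) n.lt_succ_self).2 _ ?_)
    simp only [Finset.mem_map, Finset.mem_filter, not_lt]
    rintro _ ⟨i, ⟨his, hni⟩, rfl⟩
    exact hf.monotone (hni.lt_of_ne fun h ↦ hn (h ▸ his))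
  calc ∑ i ∈ s, m (f n) (f i) ≤ δ / 2 + δ / 2 := by
        rw [← Finset.sum_filter_add_sum_filter_not s (· < n)]
        exact add_le_add hlow hhigh
    _ = δ := add_halves δ

end Subsequences

section BessagaPelczynski

variable {𝕜 : Type} [RCLike 𝕜] {X : Type*} [NormedAddCommGroup X] [NormedSpace 𝕜 X] {x : ℕ → X}

theorem mul_norm_le_of_almost_biorthogonal {φ : StrongDual 𝕜 X} {R d δ : ℝ} {n : ℕ} {k : Fin n}
    (hφ : ‖φ‖ ≤ R) (hdiag : d ≤ ‖φ (x k)‖)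
    (hoff : ∀ s : Finset ℕ, ↑k ∉ s → ∑ i ∈ s, ‖φ (x i)‖ ≤ δ) (a : Fin n → 𝕜) :
    d * ‖a k‖ ≤ R * ‖∑ i, a i • x i‖ + δ * ‖a‖ := by
  have hrest : ‖∑ i ∈ Finset.univ.erase k, φ (a i • x i)‖ ≤ δ * ‖a‖ := by
    calc ‖∑ i ∈ Finset.univ.erase k, φ (a i • x i)‖
        ≤ ∑ i ∈ Finset.univ.erase k, ‖φ (x i)‖ * ‖a‖ := by
          refine norm_sum_le_of_le _ fun i _ ↦ ?_
          rw [map_smul, norm_smul, mul_comm]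
          exact mul_le_mul_of_nonneg_left (norm_le_pi_norm a i) (norm_nonneg _)
      _ = (∑ i ∈ (Finset.univ.erase k).map Fin.valEmbedding, ‖φ (x i)‖) * ‖a‖ := by
          rw [Finset.sum_map, Finset.sum_mul]
          rfl
      _ ≤ δ * ‖a‖ := by
          gcongr
          exact hoff _ (by simp)
  calc d * ‖a k‖ ≤ ‖φ (a k • x k)‖ := by
        rw [map_smul, norm_smul, mul_comm]
        exact mul_le_mul_of_nonneg_left hdiag (norm_nonneg _)
    _ = ‖φ (∑ i, a i • x i) - ∑ i ∈ Finset.univ.erase k, φ (a i • x i)‖ := by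
        rw [map_sum, ← Finset.add_sum_erase _ _ (Finset.mem_univ k), add_sub_cancel_right]
    _ ≤ R * ‖∑ i, a i • x i‖ + δ * ‖a‖ :=
        (norm_sub_le _ _).trans (add_le_add (φ.le_of_opNorm_le hφ _) hrest)

theorem isEquivalentToCZeroBasis_of_almost_biorthogonal (hx : IsWUC 𝕜 x)
    {Φ : ℕ → StrongDual 𝕜 X} {R d δ : ℝ} (hR : 0 < R) (hΦ : ∀ n, ‖Φ n‖ ≤ R)
    (hdiag : ∀ n, d ≤ ‖Φ n (x n)‖)
    (hoff : ∀ (n : ℕ) (s : Finset ℕ), n ∉ s → ∑ i ∈ s, ‖Φ n (x i)‖ ≤ δ) (hδ : δ < d) :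
    IsEquivalentToCZeroBasis 𝕜 x := by
  obtain ⟨M, -, hM⟩ := hx.exists_forall_norm_sum_smul_le
  refine ⟨(d - δ) / R, M, div_pos (sub_pos.2 hδ) hR, fun n a ↦ ⟨?_, ?_⟩⟩
  · have hδ0 : 0 ≤ δ := hoff 0 ∅ (Finset.notMem_empty 0)
    have hd : 0 < d := hδ0.trans_lt hδ
    have hnorm : ‖a‖ ≤ (R * ‖∑ i, a i • x i‖ + δ * ‖a‖) / d := by
      refine (pi_norm_le_iff_of_nonneg (by positivity)).2 fun k ↦ ?_
      rw [le_div_iff₀ hd, mul_comm]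
      exact mul_norm_le_of_almost_biorthogonal (hΦ k) (hdiag k) (hoff k) a
    rw [le_div_iff₀ hd] at hnorm
    rw [div_mul_eq_mul_div, div_le_iff₀ hR]
    linarith
  · have hb := hM (Finset.range n) (Function.extend Fin.val a 0) ‖a‖ (norm_nonneg _) fun i hi ↦ by
      rw [Fin.val_injective.extend_apply a 0 ⟨i, Finset.mem_range.1 hi⟩]
      exact norm_le_pi_norm a _
    simpa only [← Fin.sum_univ_eq_sum_range (fun i ↦ Function.extend Fin.val a 0 i • x i),
      Fin.val_injective.extend_apply] using hb

theorem exists_tendsto_ultrafilter_of_forall_norm_le {ι : Type*} (U : Ultrafilter ι)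
    {φ : ι → StrongDual 𝕜 X} {r : ℝ} (hφ : ∀ i, ‖φ i‖ ≤ r) :
    ∃ ψ : StrongDual 𝕜 X, ‖ψ‖ ≤ r ∧ ∀ x, Tendsto (fun i ↦ φ i x) U (𝓝 (ψ x)) := by
  obtain ⟨ψ, hψ, hle⟩ := isCompact_iff_ultrafilter_le_nhds'.1
    (WeakDual.isCompact_closedBall (𝕜 := 𝕜) (E := X) 0 r)
    (U.map fun i ↦ StrongDual.toWeakDual (φ i)) (mem_map.2 (univ_mem' fun i ↦ by simpa using hφ i))
  exact ⟨WeakDual.toStrongDual ψ, by simpa using hψ,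
    fun x ↦ ((WeakDual.eval_continuous x).tendsto ψ).comp hle⟩

/-- The functionals are norming ones for the `x j`, minus a weak-* cluster point. -/
theorem IsWUC.exists_forall_tendsto_zero_and_eventually_norm_sub_le (hx : IsWUC 𝕜 x) {δ : ℝ}
    (hδ : 0 < δ) :
    ∃ Φ : ℕ → StrongDual 𝕜 X, (∀ j, ‖Φ j‖ ≤ 2) ∧
      (∀ z, Tendsto (fun j ↦ Φ j z) (hyperfilter ℕ) (𝓝 0)) ∧
      ∀ᶠ j in hyperfilter ℕ, ‖x j‖ - δ ≤ ‖Φ j (x j)‖ := by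
  choose φ hφ hφx using fun j ↦ exists_dual_vector'' 𝕜 (x j)
  obtain ⟨ψ, hψ, hφψ⟩ := exists_tendsto_ultrafilter_of_forall_norm_le (hyperfilter ℕ) hφ
  refine ⟨fun j ↦ φ j - ψ, fun j ↦ ?_, fun z ↦ tendsto_sub_nhds_zero_iff.2 (hφψ z), ?_⟩
  · exact (norm_sub_le_of_le (hφ j) hψ).trans_eq one_add_one_eq_two
  · refine Nat.hyperfilter_le_atTop ?_
    filter_upwards [(hx ψ).tendsto_atTop_zero.eventually (eventually_le_nhds hδ)] with j hj
    have hnorming : ‖φ j (x j)‖ = ‖x j‖ := by rw [hφx, RCLike.norm_ofReal, abs_norm]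
    calc ‖x j‖ - δ ≤ ‖φ j (x j)‖ - ‖ψ (x j)‖ := by rw [hnorming]; gcongr
      _ ≤ ‖(φ j - ψ) (x j)‖ := norm_sub_norm_le _ _

theorem IsWUC.exists_subseq_isEquivalentToCZeroBasis (hx : IsWUC 𝕜 x) {ε : ℝ} (hε : 0 < ε)
    (hxε : ∀ j, ε ≤ ‖x j‖) :
    ∃ f : ℕ → ℕ, StrictMono f ∧ IsEquivalentToCZeroBasis 𝕜 (x ∘ f) := by
  obtain ⟨Φ, hΦ, hΦ0, hΦx⟩ :=
    hx.exists_forall_tendsto_zero_and_eventually_norm_sub_le (δ := ε / 4) (by positivity)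
  obtain ⟨f, hf, hdiag, hoff⟩ := exists_strictMono_forall_sum_le Nat.hyperfilter_le_atTop
    (fun j ↦ hx (Φ j)) (fun i ↦ by simpa using (hΦ0 (x i)).norm) hΦx (δ := ε / 4) (by positivity)
  refine ⟨f, hf, isEquivalentToCZeroBasis_of_almost_biorthogonal (hx.comp_injective hf.injective)
    two_pos (fun n ↦ hΦ (f n)) (d := 3 / 4 * ε) (fun n ↦ ?_) hoff (by linarith)⟩
  have := hdiag n
  have := hxε (f n)
  simp only [Function.comp_apply]
  linarith

theorem IsWUC.exists_disjoint_blocks_isEquivalentToCZeroBasis [CompleteSpace X]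
    (hx : IsWUC 𝕜 x) (hns : ¬ Summable x) :
    ∃ B : ℕ → Finset ℕ, Pairwise (Function.onFun Disjoint B) ∧
      IsEquivalentToCZeroBasis 𝕜 fun m ↦ ∑ i ∈ B m, x i := by
  rw [summable_iff_vanishing_norm] at hns
  push Not at hns
  obtain ⟨ε, hε, hns⟩ := hns
  obtain ⟨B, hB, hdisj⟩ := exists_seq_of_forall_finset_exists'
    (fun t : Finset ℕ ↦ ε ≤ ‖∑ i ∈ t, x i‖) Disjoint fun s _ ↦ by
      obtain ⟨t, htd, ht⟩ := hns (s.biUnion id)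
      exact ⟨t, ht, fun u hu ↦ (htd.mono_right (Finset.subset_biUnion_of_mem id hu)).symm⟩
  obtain ⟨f, hf, hbasis⟩ := (hx.sum_blocks hdisj).exists_subseq_isEquivalentToCZeroBasis hε hB
  exact ⟨B ∘ f, hdisj.comp_of_injective hf.injective, hbasis⟩

end BessagaPelczynski

section CZeroBasis

variable {𝕜 : Type} [RCLike 𝕜] {X : Type*} [NormedAddCommGroup X] [NormedSpace 𝕜 X] {x : ℕ → X}

theorem IsEquivalentToCZeroBasis.exists_forall_norm_sum_range
    (hx : IsEquivalentToCZeroBasis 𝕜 x) :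
    ∃ c C : ℝ, 0 < c ∧ ∀ (n : ℕ) (a : ℕ → 𝕜),
      (∀ i < n, c * ‖a i‖ ≤ ‖∑ i ∈ Finset.range n, a i • x i‖) ∧
      ((∀ i, ‖a i‖ ≤ 1) → ‖∑ i ∈ Finset.range n, a i • x i‖ ≤ C) := by
  obtain ⟨c, C, hc, h⟩ := hx
  refine ⟨c, |C|, hc, fun n a ↦ ?_⟩
  obtain ⟨hlow, hup⟩ := h n fun i ↦ a i
  rw [Fin.sum_univ_eq_sum_range fun i ↦ a i • x i] at hlow hup
  refine ⟨fun i hi ↦ le_trans ?_ hlow, fun ha ↦ hup.trans ?_⟩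
  · exact mul_le_mul_of_nonneg_left (norm_le_pi_norm (fun i : Fin n ↦ a i) ⟨i, hi⟩) hc.le
  · have ha' : ‖fun i : Fin n ↦ a i‖ ≤ 1 :=
      (pi_norm_le_iff_of_nonneg zero_le_one).2 fun i ↦ ha i
    exact (le_abs_self _).trans ((abs_mul _ _).trans_le
      (mul_le_of_le_one_right (abs_nonneg C) ((abs_norm _).trans_le ha')))

theorem IsEquivalentToCZeroBasis.isWUC (hx : IsEquivalentToCZeroBasis 𝕜 x) : IsWUC 𝕜 x := by
  obtain ⟨_, _, -, h⟩ := hx.exists_forall_norm_sum_range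
  exact IsWUC.of_forall_norm_sum_range_le fun n a ↦ (h n a).2

theorem IsEquivalentToCZeroBasis.not_isUC (hx : IsEquivalentToCZeroBasis 𝕜 x) : ¬ IsUC x := by
  obtain ⟨_, _, hc, h⟩ := hx.exists_forall_norm_sum_range
  refine fun hUC ↦ hc.not_ge (norm_zero (E := X) ▸ ge_of_tendsto' hUC.tendsto_zero.norm fun n ↦ ?_)
  simpa [Finset.sum_range_succ, Finset.sum_eq_zero, Pi.single_apply] using
    (h (n + 1) (Pi.single n 1)).1 n n.lt_succ_self

end CZeroBasis

section CZero

variable {𝕜 : Type} [RCLike 𝕜]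

namespace CZero

theorem norm_apply_le (a : CZero 𝕜) (i : ℕ) : ‖a i‖ ≤ ‖a‖ :=
  a.toBCF.norm_coe_le_norm i

theorem norm_le {a : CZero 𝕜} {C : ℝ} (hC : 0 ≤ C) (h : ∀ i, ‖a i‖ ≤ C) : ‖a‖ ≤ C :=
  (a.toBCF.norm_le hC).2 h

theorem tendsto_zero (a : CZero 𝕜) : Tendsto a atTop (𝓝 0) := by
  simpa only [cocompact_eq_cofinite, Nat.cofinite_eq_atTop] using zero_at_infty a

variable (𝕜) in
/-- The `i`-th coordinate functional on `c₀`. -/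
noncomputable def coord (i : ℕ) : StrongDual 𝕜 (CZero 𝕜) :=
  LinearMap.mkContinuous
    { toFun := fun a ↦ a i
      map_add' := fun _ _ ↦ rfl
      map_smul' := fun _ _ ↦ rfl } 1 fun a ↦ by simpa using norm_apply_le a i

@[simp]
theorem coord_apply (i : ℕ) (a : CZero 𝕜) : coord 𝕜 i a = a i := rfl

theorem sum_apply (s : Finset ℕ) (z : ℕ → CZero 𝕜) (i : ℕ) : (∑ m ∈ s, z m) i = ∑ m ∈ s, z m i :=
  map_sum (coord 𝕜 i) z s

/-- The restriction of a sequence of scalars to a finite set of indices, as an element of `c₀`. -/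
def restrict (s : Finset ℕ) (f : ℕ → 𝕜) : CZero 𝕜 where
  toFun i := if i ∈ s then f i else 0
  continuous_toFun := continuous_of_discreteTopology
  zero_at_infty' := by
    rw [cocompact_eq_cofinite]
    refine tendsto_const_nhds.congr' ?_
    filter_upwards [s.finite_toSet.compl_mem_cofinite] with i hi
    exact (if_neg hi).symm

theorem restrict_apply (s : Finset ℕ) (f : ℕ → 𝕜) (i : ℕ) :
    restrict s f i = if i ∈ s then f i else 0 := rfl

theorem isWUC_restrict {B : ℕ → Finset ℕ} (hB : Pairwise (Function.onFun Disjoint B))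
    {g : ℕ → ℕ → 𝕜} {R : ℝ} (hg : ∀ n i, ‖g n i‖ ≤ R) :
    IsWUC 𝕜 fun n ↦ restrict (B n) (g n) := by
  have hR : 0 ≤ R := (norm_nonneg _).trans (hg 0 0)
  refine IsWUC.of_forall_norm_sum_range_le (M := R) fun N a ha ↦ norm_le hR fun i ↦ ?_
  rw [sum_apply]
  by_cases hi : ∃ m ∈ Finset.range N, i ∈ B m
  · obtain ⟨m, hm, him⟩ := hi
    rw [Finset.sum_eq_single_of_mem m hm fun n _ hnm ↦ ?_]
    · calc ‖(a m • restrict (B m) (g m)) i‖ = ‖a m‖ * ‖g m i‖ := by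
            simp [restrict_apply, him]
        _ ≤ 1 * R := mul_le_mul (ha m) (hg m i) (norm_nonneg _) zero_le_one
        _ = R := one_mul R
    · simp [restrict_apply, Finset.disjoint_right.1 (hB hnm) him]
  · push Not at hi
    rwa [Finset.sum_eq_zero fun m hm ↦ by simp [restrict_apply, hi m hm], norm_zero]

variable (𝕜) in
/-- The `n`-th vector of the unit vector basis of `c₀`. -/
def basis (n : ℕ) : CZero 𝕜 := restrict {n} 1

theorem basis_apply (n i : ℕ) : basis 𝕜 n i = if i = n then 1 else 0 := by
  simp [basis, restrict_apply]

variable (𝕜) in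
theorem isWUC_basis : IsWUC 𝕜 (basis 𝕜) :=
  isWUC_restrict (R := 1) (fun i j hij ↦ by simpa [Function.onFun] using hij) (by simp)

theorem norm_sum_smul_basis {n : ℕ} (a : Fin n → 𝕜) : ‖∑ i, a i • basis 𝕜 i‖ = ‖a‖ := by
  have hlt (j : Fin n) : (∑ i, a i • basis 𝕜 i) j = a j := by
    rw [← coord_apply, map_sum]
    simp [basis_apply, Fin.val_inj]
  have hge (j : ℕ) (hj : n ≤ j) : (∑ i, a i • basis 𝕜 i) j = 0 := by
    rw [← coord_apply, map_sum]
    exact Finset.sum_eq_zero fun i _ ↦ by simp [basis_apply, (i.isLt.trans_le hj).ne']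
  refine le_antisymm (norm_le (norm_nonneg a) fun j ↦ ?_)
    ((pi_norm_le_iff_of_nonneg (norm_nonneg _)).2 fun i ↦ ?_)
  · obtain hj | hj := lt_or_ge j n
    · exact (congrArg norm (hlt ⟨j, hj⟩)).trans_le (norm_le_pi_norm a _)
    · simp [hge j hj]
  · exact hlt i ▸ norm_apply_le _ _

end CZero

end CZero

section Synthesis

variable {𝕜 : Type} [RCLike 𝕜] {X Z : Type*} [NormedAddCommGroup X] [NormedSpace 𝕜 X]
  [NormedAddCommGroup Z] [NormedSpace 𝕜 Z] {x : ℕ → X}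

theorem isEquivalentToCZeroBasis_of_antilipschitz {T : CZero 𝕜 →L[𝕜] X}
    (hT : ∃ K, AntilipschitzWith K T) : IsEquivalentToCZeroBasis 𝕜 (T ∘ CZero.basis 𝕜) := by
  obtain ⟨K, hK⟩ := hT
  refine ⟨(K + 1 : ℝ)⁻¹, ‖T‖, by positivity, fun n a ↦ ?_⟩
  have hsum : ∑ i, a i • (T ∘ CZero.basis 𝕜) i = T (∑ i, a i • CZero.basis 𝕜 i) := by
    simp only [map_sum, map_smul, Function.comp_apply]
  rw [hsum, ← CZero.norm_sum_smul_basis a]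
  refine ⟨?_, T.le_opNorm _⟩
  rw [inv_mul_le_iff₀ (by positivity)]
  refine (T.bound_of_antilipschitz hK _).trans ?_
  gcongr
  simp

theorem not_isUnconditionallyConverging_of_antilipschitz {T : CZero 𝕜 →L[𝕜] X}
    (hT : ∃ K, AntilipschitzWith K T) : ¬ IsUnconditionallyConverging 𝕜 T :=
  fun h ↦ (isEquivalentToCZeroBasis_of_antilipschitz hT).not_isUC (h.isUC (CZero.isWUC_basis 𝕜))

variable [CompleteSpace X]

theorem IsWUC.summable_smul (hx : IsWUC 𝕜 x) (a : CZero 𝕜) : Summable fun i ↦ a i • x i := by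
  obtain ⟨M, hM0, hM⟩ := hx.exists_forall_norm_sum_smul_le
  rw [summable_iff_vanishing_norm]
  intro ε hε
  have hδ : 0 < ε / (M + 1) := by positivity
  obtain ⟨N, hN⟩ := eventually_atTop.1
    ((tendsto_zero_iff_norm_tendsto_zero.1 a.tendsto_zero).eventually (eventually_le_nhds hδ))
  refine ⟨Finset.range N, fun t ht ↦ ?_⟩
  calc ‖∑ i ∈ t, a i • x i‖ ≤ M * (ε / (M + 1)) :=
        hM t a _ hδ.le fun i hi ↦ hN i (by simpa using Finset.disjoint_left.1 ht hi)
    _ < (M + 1) * (ε / (M + 1)) := by gcongr; exact lt_add_one M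
    _ = ε := by field_simp

/-- The operator `c₀ → X`, `a ↦ ∑ aᵢ xᵢ`, defined by a w.u.C. series `∑ xᵢ`. -/
noncomputable def synthesis (x : ℕ → X) (hx : IsWUC 𝕜 x) : CZero 𝕜 →L[𝕜] X :=
  LinearMap.mkContinuousOfExistsBound
    { toFun := fun a ↦ ∑' i, a i • x i
      map_add' := fun a b ↦ by
        simp only [ZeroAtInftyContinuousMap.add_apply, add_smul]
        exact (hx.summable_smul a).tsum_add (hx.summable_smul b)
      map_smul' := fun c a ↦ by
        simp only [ZeroAtInftyContinuousMap.smul_apply, smul_assoc, RingHom.id_apply]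
        exact (hx.summable_smul a).tsum_const_smul c } (by
    obtain ⟨M, -, hM⟩ := hx.exists_forall_norm_sum_smul_le
    exact ⟨M, fun a ↦ le_of_tendsto (hx.summable_smul a).hasSum.norm (Eventually.of_forall fun S ↦
      hM S a _ (norm_nonneg _) fun i _ ↦ CZero.norm_apply_le a i)⟩)

theorem hasSum_synthesis (hx : IsWUC 𝕜 x) (a : CZero 𝕜) :
    HasSum (fun i ↦ a i • x i) (synthesis x hx a) :=
  (hx.summable_smul a).hasSum

theorem comp_synthesis [CompleteSpace Z] (T : X →L[𝕜] Z) (hx : IsWUC 𝕜 x) :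
    T ∘L synthesis x hx = synthesis (T ∘ x) (hx.map T) := by
  ext a
  refine HasSum.unique ?_ (hasSum_synthesis (hx.map T) a)
  simpa using (hasSum_synthesis hx a).mapL T

theorem synthesis_basis (hx : IsWUC 𝕜 x) (n : ℕ) : synthesis x hx (CZero.basis 𝕜 n) = x n := by
  refine (hasSum_synthesis hx _).unique ?_
  simpa [CZero.basis_apply] using hasSum_single (f := fun i ↦ CZero.basis 𝕜 n i • x i) n
    fun i hi ↦ by simp [CZero.basis_apply, hi]

theorem synthesis_comp_basis (T : CZero 𝕜 →L[𝕜] X) :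
    synthesis (T ∘ CZero.basis 𝕜) ((CZero.isWUC_basis 𝕜).map T) = T := by
  have hid : synthesis _ (CZero.isWUC_basis 𝕜) = ContinuousLinearMap.id 𝕜 (CZero 𝕜) := by
    ext a j
    refine ((hasSum_synthesis (CZero.isWUC_basis 𝕜) a).mapL (CZero.coord 𝕜 j)).unique ?_
    simpa [CZero.basis_apply] using hasSum_single (f := fun i ↦ a i • CZero.basis 𝕜 i j) j
      fun i hi ↦ by simp [CZero.basis_apply, hi.symm]
  rw [← comp_synthesis T (CZero.isWUC_basis 𝕜), hid, ContinuousLinearMap.comp_id]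

theorem IsEquivalentToCZeroBasis.exists_antilipschitz_synthesis
    (hx : IsEquivalentToCZeroBasis 𝕜 x) : ∃ K, AntilipschitzWith K (synthesis x hx.isWUC) := by
  obtain ⟨c, _, hc, h⟩ := hx.exists_forall_norm_sum_range
  refine ⟨Real.toNNReal c⁻¹, ContinuousLinearMap.antilipschitz_of_bound _ fun a ↦
    CZero.norm_le (by positivity) fun l ↦ ?_⟩
  rw [Real.coe_toNNReal _ (inv_nonneg.2 hc.le), le_inv_mul_iff₀ hc]
  refine ge_of_tendsto (hasSum_synthesis hx.isWUC a).tendsto_sum_nat.norm ?_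
  filter_upwards [eventually_gt_atTop l] with n hn
  exact (h n a).1 l hn

theorem exists_antilipschitz_comp_of_not_isUnconditionallyConverging [CompleteSpace Z]
    {T : X →L[𝕜] Z} (hT : ¬ IsUnconditionallyConverging 𝕜 T) :
    ∃ J : CZero 𝕜 →L[𝕜] X, ∃ K, AntilipschitzWith K (T ∘L J) := by
  rw [IsUnconditionallyConverging] at hT
  push Not at hT
  obtain ⟨y, hy, hTy⟩ := hT
  have hns : ¬ Summable (T ∘ y) := fun hs ↦
    hTy _ (by simpa only [map_sum, Function.comp_apply] using hs.hasSum.tendsto_sum_nat)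
  obtain ⟨B, hB, hBx⟩ := (hy.map T).exists_disjoint_blocks_isEquivalentToCZeroBasis hns
  have hTB : T ∘ (fun m ↦ ∑ i ∈ B m, y i) = fun m ↦ ∑ i ∈ B m, (T ∘ y) i :=
    funext fun m ↦ map_sum T _ _
  refine ⟨synthesis _ (hy.sum_blocks hB), ?_⟩
  rw [comp_synthesis]
  exact (hTB ▸ hBx).exists_antilipschitz_synthesis

end Synthesis

section PolynomialsOnCZero

variable {𝕜 : Type} [RCLike 𝕜]

theorem CZero.exists_tendsto_subseq {v : ℕ → CZero 𝕜} {R : ℝ} (hv : ∀ n, ‖v n‖ ≤ R) :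
    ∃ (α : ℕ → 𝕜) (f : ℕ → ℕ), StrictMono f ∧ (∀ i, ‖α i‖ ≤ R) ∧
      ∀ i, Tendsto (fun n ↦ v (f n) i) atTop (𝓝 (α i)) := by
  have hcompact : IsCompact (Set.pi Set.univ fun _ : ℕ ↦ Metric.closedBall (0 : 𝕜) R) :=
    isCompact_univ_pi fun _ ↦ isCompact_closedBall _ _
  obtain ⟨α, hαR, f, hf, hα⟩ := hcompact.tendsto_subseq (x := fun n i ↦ v n i) fun n i _ ↦
    mem_closedBall_zero_iff.2 ((norm_apply_le _ _).trans (hv n))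
  exact ⟨α, f, hf, fun i ↦ mem_closedBall_zero_iff.1 (hαR i trivial), tendsto_pi_nhds.1 hα⟩

theorem CZero.exists_strictMono_norm_sub_le_and_norm_le {v : ℕ → CZero 𝕜} {α : ℕ → 𝕜}
    (hα : ∀ i, Tendsto (fun n ↦ v n i) atTop (𝓝 (α i))) :
    ∃ f N : ℕ → ℕ, StrictMono f ∧ StrictMono N ∧ ∀ n,
      (∀ i < N n, ‖v (f n) i - α i‖ ≤ 1 / ((N n : ℝ) + 1)) ∧
      ∀ i ≥ N (n + 1), ‖v (f n) i‖ ≤ 1 / ((N n : ℝ) + 1) := by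
  obtain ⟨f, hf, hfα⟩ := extraction_forall_of_eventually
    (P := fun N n ↦ ∀ i < N, ‖v n i - α i‖ ≤ 1 / ((N : ℝ) + 1)) fun N ↦
      (Set.finite_lt_nat N).eventually_all.2 fun i _ ↦
        (tendsto_iff_norm_sub_tendsto_zero.1 (hα i)).eventually
          (eventually_le_nhds (by positivity))
  obtain ⟨N, hN, -, hNv⟩ := exists_strictMono_forall_lt_of_eventually (p := fun _ ↦ True)
    (r := fun m N ↦ ∀ i ≥ N, ‖v (f m) i‖ ≤ 1 / ((m : ℝ) + 1)) le_rfl (by simp) fun m ↦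
      eventually_forall_ge_atTop.2 <|
        (tendsto_zero_iff_norm_tendsto_zero.1 (v (f m)).tendsto_zero).eventually
          (eventually_le_nhds (by positivity))
  exact ⟨f ∘ N, N, hf.comp hN, hN, fun n ↦ ⟨hfα (N n), hNv n (n + 1) n.lt_succ_self⟩⟩

theorem pairwise_disjoint_Ico_of_monotone {N : ℕ → ℕ} (hN : Monotone N) :
    Pairwise (Function.onFun Disjoint fun n ↦ Finset.Ico (N n) (N (n + 1))) := fun m n hmn ↦ by
  simpa [Function.onFun, ← Finset.disjoint_coe] using hN.pairwise_disjoint_on_Ico_succ hmn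

/-- Here `b n` follows the coordinatewise limit of `v` up to an index `N n`, and `v` itself from
there to `N (n + 1)`. -/
theorem CZero.exists_subseq_asymptotic_isWUC {v : ℕ → CZero 𝕜} {R : ℝ} (hv : ∀ n, ‖v n‖ ≤ R) :
    ∃ (f : ℕ → ℕ) (b : ℕ → CZero 𝕜), StrictMono f ∧ (∀ n, ‖b n‖ ≤ R) ∧
      IsWUC 𝕜 (fun n ↦ b (n + 1) - b n) ∧ Tendsto (fun n ↦ ‖v (f n) - b n‖) atTop (𝓝 0) := by
  have hR : 0 ≤ R := (norm_nonneg _).trans (hv 0)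
  have hvR (n i) : ‖v n i‖ ≤ R := (norm_apply_le _ i).trans (hv n)
  obtain ⟨α, f₀, hf₀, hαR, hα⟩ := exists_tendsto_subseq hv
  obtain ⟨f, N, hf, hN, hfN⟩ := exists_strictMono_norm_sub_le_and_norm_le hα
  have hdisj := pairwise_disjoint_Ico_of_monotone hN.monotone
  have hN₀ (n) : (0 : ℝ) ≤ 1 / ((N n : ℝ) + 1) := by positivity
  have hlt (n) : N n < N (n + 1) := hN n.lt_succ_self
  let b (n : ℕ) : CZero 𝕜 :=
    restrict (Finset.range (N (n + 1))) fun i ↦ if i < N n then α i else v (f₀ (f n)) i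
  have hb (n i) : b n i =
      if i < N n then α i else if i < N (n + 1) then v (f₀ (f n)) i else 0 := by
    simp only [b, restrict_apply, Finset.mem_range]
    grind
  have hdiff (n) : b (n + 1) - b n =
      restrict (Finset.Ico (N n) (N (n + 1))) (fun i ↦ α i - v (f₀ (f n)) i) +
      restrict (Finset.Ico (N (n + 1)) (N (n + 1 + 1))) (v (f₀ (f (n + 1)))) := by
    ext i
    simp only [ZeroAtInftyContinuousMap.sub_apply, ZeroAtInftyContinuousMap.add_apply, hb,
      restrict_apply, Finset.mem_Ico]
    have h₁ := hlt n
    have h₂ := hlt (n + 1)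
    split_ifs <;> first | omega | simp
  refine ⟨f₀ ∘ f, b, hf₀.comp hf, fun n ↦ norm_le hR fun i ↦ ?_, ?_, ?_⟩
  · rw [hb]
    split_ifs
    exacts [hαR i, hvR _ i, by simpa]
  · simp only [hdiff]
    refine (isWUC_restrict (R := R + R) hdisj fun n i ↦ ?_).add
      ((isWUC_restrict (g := fun n ↦ v (f₀ (f n))) hdisj fun n ↦ hvR _).comp_injective
        Nat.succ_injective)
    exact norm_sub_le_of_le (hαR i) (hvR _ i)
  · refine squeeze_zero (fun _ ↦ norm_nonneg _) (fun n ↦ norm_le (hN₀ n) fun i ↦ ?_)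
      (tendsto_one_div_add_atTop_nhds_zero_nat.comp hN.tendsto_atTop)
    rw [ZeroAtInftyContinuousMap.sub_apply, hb, Function.comp_apply]
    split_ifs with h h'
    · exact (hfN n).1 i h
    · rw [sub_self, norm_zero]
      exact hN₀ n
    · rw [sub_zero]
      exact (hfN n).2 i (not_lt.1 h')

theorem IsUnconditionallyConverging.exists_tendsto {X Y : Type*} [NormedAddCommGroup X]
    [NormedSpace 𝕜 X] [NormedAddCommGroup Y] {Q : X → Y} (hQ : IsUnconditionallyConverging 𝕜 Q)
    {b : ℕ → X} (hb : IsWUC 𝕜 fun n ↦ b (n + 1) - b n) :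
    ∃ y, Tendsto (Q ∘ b) atTop (𝓝 y) := by
  let z (n : ℕ) : X := n.casesOn (b 0) fun m ↦ b (m + 1) - b m
  have hz : IsWUC 𝕜 z := fun φ ↦ (summable_nat_add_iff 1).1 (hb φ)
  obtain ⟨y, hy⟩ := hQ z hz
  refine ⟨y, ((tendsto_add_atTop_iff_nat 1).2 hy).congr fun n ↦ congrArg Q ?_⟩
  rw [Finset.sum_range_succ', Finset.sum_range_sub]
  exact sub_add_cancel _ _

theorem IsUnconditionallyConverging.mapsBoundedToRelCompact {Y : Type*} [NormedAddCommGroup Y]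
    [NormedSpace 𝕜 Y] {k : ℕ} {Q : CZero 𝕜 → Y} (hQ : IsUnconditionallyConverging 𝕜 Q)
    (hk : IsHomogeneousPolynomial 𝕜 k Q) : MapsBoundedToRelCompact Q := by
  intro w hw
  obtain ⟨R, hR⟩ := hw.exists_norm_le
  refine isRelCompact_of_forall_exists_tendsto fun u hu ↦ ?_
  choose m hm using hu
  have hwR (n) : ‖w (m n)‖ ≤ R := hR _ ⟨m n, rfl⟩
  obtain ⟨f, b, hf, hbR, hb, hwb⟩ := CZero.exists_subseq_asymptotic_isWUC hwR
  obtain ⟨y, hy⟩ := hQ.exists_tendsto hb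
  obtain ⟨C, hC⟩ := hk.exists_forall_norm_sub_le R
  refine ⟨y, f, hf, hy.congr_dist (squeeze_zero (fun _ ↦ dist_nonneg) (fun n ↦ ?_)
    (by simpa using hwb.const_mul C))⟩
  rw [dist_comm, dist_eq_norm, Function.comp_apply, ← hm]
  exact hC _ _ (hwR _) (hbR n)

end PolynomialsOnCZero

section Characterizations

variable {𝕜 : Type} [RCLike 𝕜] {X Y Z : Type*} [NormedAddCommGroup X] [NormedSpace 𝕜 X]
  [NormedAddCommGroup Y] [NormedAddCommGroup Z] [NormedSpace 𝕜 Z] {k : ℕ} {P : X → Y}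

variable (𝕜) in
/-- `P` is compact on some isomorphic copy of `c₀` in its domain, the copy being given by an
embedding `c₀ → X`. This is the obstruction whose absence all the assertions express. -/
def IsCompactOnCopyOfCZero (P : X → Y) : Prop :=
  ∃ T : CZero 𝕜 →L[𝕜] X, (∃ K, AntilipschitzWith K T) ∧ IsCompactPolynomial (P ∘ T)

theorem IsIsomorphicToCZero.containsCZero (hX : IsIsomorphicToCZero 𝕜 X) : ContainsCZero 𝕜 X :=
  hX.elim fun e ↦ ⟨⊤, ⟨Submodule.topContEquiv.trans e⟩⟩

theorem ContainsCZero.exists_antilipschitz (hX : ContainsCZero 𝕜 X) :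
    ∃ T : CZero 𝕜 →L[𝕜] X, ∃ K, AntilipschitzWith K T := by
  obtain ⟨N, ⟨e⟩⟩ := hX
  exact ⟨N.subtypeL ∘L e.symm, _, N.subtypeₗᵢ.antilipschitz.comp e.symm.antilipschitz⟩

theorem exists_not_of_forall_isUC {W : Type*} {P : X → W} {C : Set W → Prop}
    (h : ∀ x : ℕ → X, IsWUC 𝕜 x →
      (∀ a : ℕ → CZero 𝕜, Bornology.IsBounded (Set.range a) → C (imageSet P x a)) → IsUC x)
    (x : ℕ → X) (hx : IsEquivalentToCZeroBasis 𝕜 x) :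
    ∃ a : ℕ → CZero 𝕜, Bornology.IsBounded (Set.range a) ∧ ¬ C (imageSet P x a) := by
  by_contra! hC
  exact hx.not_isUC (h x hx.isWUC hC)

/-- `c₀` lives in the lowest universe, whereas the spaces in (E) range over an arbitrary one. -/
theorem isUnconditionallyConverging_of_forall_universe
    (h : ∀ (E : Type w) [NormedAddCommGroup E] [NormedSpace 𝕜 E] [CompleteSpace E] (T : E →L[𝕜] X),
      IsUnconditionallyConverging 𝕜 (P ∘ T) → IsUnconditionallyConverging 𝕜 T)
    {E : Type} [NormedAddCommGroup E] [NormedSpace 𝕜 E] [CompleteSpace E] (T : E →L[𝕜] X)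
    (hT : IsUnconditionallyConverging 𝕜 (P ∘ T)) : IsUnconditionallyConverging 𝕜 T := by
  let e : ULift.{w} E ≃L[𝕜] E := ContinuousLinearEquiv.ulift
  have he := h (ULift.{w} E) (T ∘L e) (hT.comp (e : ULift.{w} E →L[𝕜] E))
  exact he.comp (e.symm : E →L[𝕜] ULift.{w} E)

variable [NormedSpace 𝕜 Y]

theorem isCompactOnCopyOfCZero_of_isUnconditionallyConverging_comp
    (hP : IsHomogeneousPolynomial 𝕜 k P) {T : CZero 𝕜 →L[𝕜] X} (hT : ∃ K, AntilipschitzWith K T)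
    (hPT : IsUnconditionallyConverging 𝕜 (P ∘ T)) : IsCompactOnCopyOfCZero 𝕜 P :=
  ⟨T, hT, (hPT.mapsBoundedToRelCompact (hP.comp T)).isCompactPolynomial⟩

theorem isCompactOnCopyOfCZero_of_containsCZero (hP : IsHomogeneousPolynomial 𝕜 k P)
    {M : Submodule 𝕜 X} (hM : ContainsCZero 𝕜 M)
    (hPM : IsUnconditionallyConverging 𝕜 (P ∘ M.subtypeL)) : IsCompactOnCopyOfCZero 𝕜 P := by
  obtain ⟨T, K, hT⟩ := hM.exists_antilipschitz
  exact isCompactOnCopyOfCZero_of_isUnconditionallyConverging_comp hP (T := M.subtypeL ∘L T)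
    ⟨_, M.subtypeₗᵢ.antilipschitz.comp hT⟩ (hPM.comp T)

theorem IsHomogeneousPolynomial.isUnconditionallyConverging_of_isCompactPolynomial
    [CompleteSpace Y] (hP : IsHomogeneousPolynomial 𝕜 k P) (hPc : IsCompactPolynomial P) :
    IsUnconditionallyConverging 𝕜 P :=
  hP.isUnconditionallyConverging (hP.isCompactPolynomial_iff.1 hPc).mapsBoundedToRelWeaklyCompact

variable [CompleteSpace X]

theorem not_isCompactOnCopyOfCZero_iff (hP : IsHomogeneousPolynomial 𝕜 k P) :
    ¬ IsCompactOnCopyOfCZero 𝕜 P ↔ ∀ x : ℕ → X, IsEquivalentToCZeroBasis 𝕜 x →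
      ∃ a : ℕ → CZero 𝕜, Bornology.IsBounded (Set.range a) ∧ ¬ IsRelCompact (imageSet P x a) := by
  constructor
  · intro h x hx
    by_contra! hc
    exact h ⟨synthesis x hx.isWUC, hx.exists_antilipschitz_synthesis,
      MapsBoundedToRelCompact.isCompactPolynomial hc⟩
  · rintro h ⟨T, hT, hc⟩
    obtain ⟨a, ha, hna⟩ := h _ (isEquivalentToCZeroBasis_of_antilipschitz hT)
    rw [← synthesis_comp_basis T] at hc
    exact hna ((hP.comp _).isCompactPolynomial_iff.1 hc a ha)

theorem isUnconditionallyConverging_of_comp [CompleteSpace Z]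
    (hP : IsHomogeneousPolynomial 𝕜 k P) (h : ¬ IsCompactOnCopyOfCZero 𝕜 P) (T : Z →L[𝕜] X)
    (hPT : IsUnconditionallyConverging 𝕜 (P ∘ T)) : IsUnconditionallyConverging 𝕜 T := by
  by_contra hT
  obtain ⟨J, hJ⟩ := exists_antilipschitz_comp_of_not_isUnconditionallyConverging hT
  exact h (isCompactOnCopyOfCZero_of_isUnconditionallyConverging_comp hP hJ (hPT.comp J))

theorem isUC_of_forall_isRelWeaklyCompact_imageSet [CompleteSpace Y]
    (hP : IsHomogeneousPolynomial 𝕜 k P) (h : ¬ IsCompactOnCopyOfCZero 𝕜 P) {x : ℕ → X}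
    (hx : IsWUC 𝕜 x) (hw : ∀ a : ℕ → CZero 𝕜, Bornology.IsBounded (Set.range a) →
      IsRelWeaklyCompact 𝕜 (imageSet P x a)) : IsUC x := by
  have hPT := (hP.comp (synthesis x hx)).isUnconditionallyConverging hw
  have hT := isUnconditionallyConverging_of_comp hP h _ hPT
  simpa only [Function.comp_def, synthesis_basis] using hT.isUC (CZero.isWUC_basis 𝕜)

theorem isCompactOperator_of_isCompactPolynomial_comp [CompleteSpace Y]
    (hP : IsHomogeneousPolynomial 𝕜 k P) (h : ¬ IsCompactOnCopyOfCZero 𝕜 P) (T : CZero 𝕜 →L[𝕜] X)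
    (hPT : IsCompactPolynomial (P ∘ T)) : IsCompactOperator T := by
  have hT : IsUnconditionallyConverging 𝕜 T := isUnconditionallyConverging_of_comp hP h T
    ((hP.comp T).isUnconditionallyConverging_of_isCompactPolynomial hPT)
  exact (isCompactOperator_iff_isCompactPolynomial T).2
    (hT.mapsBoundedToRelCompact (isHomogeneousPolynomial_one T)).isCompactPolynomial

theorem not_isCompactOperator_of_antilipschitz {T : CZero 𝕜 →L[𝕜] X}
    (hT : ∃ K, AntilipschitzWith K T) : ¬ IsCompactOperator T := fun hc ↦
  not_isUnconditionallyConverging_of_antilipschitz hT <|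
    (isHomogeneousPolynomial_one T).isUnconditionallyConverging_of_isCompactPolynomial
      ((isCompactOperator_iff_isCompactPolynomial T).1 hc)

theorem IsCompactOnCopyOfCZero.exists_submodule (hP : IsHomogeneousPolynomial 𝕜 k P)
    (h : IsCompactOnCopyOfCZero 𝕜 P) :
    ∃ M : Submodule 𝕜 X, IsClosed (M : Set X) ∧ IsIsomorphicToCZero 𝕜 M ∧
      IsCompactPolynomial (P ∘ M.subtypeL) := by
  obtain ⟨T, ⟨K, hT⟩, hc⟩ := h
  have hclosed : IsClosed (Set.range T) := hT.isClosed_range T.uniformContinuous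
  let e : CZero 𝕜 ≃L[𝕜] T.range := T.equivRange hT.injective hclosed
  refine ⟨T.range, hclosed, ⟨e.symm⟩, ?_⟩
  have hcomp : P ∘ T.range.subtypeL = (P ∘ T) ∘ (e.symm : T.range →L[𝕜] CZero 𝕜) :=
    funext fun m ↦ congrArg P (congrArg Subtype.val (e.apply_symm_apply m)).symm
  rw [hcomp]
  exact (((hP.comp T).isCompactPolynomial_iff.1 hc).comp _).isCompactPolynomial

end Characterizations

end OrliczPettis

theorem theorem2p1 {𝕜 : Type} [RCLike 𝕜]
    {X : Type u} [NormedAddCommGroup X] [NormedSpace 𝕜 X] [CompleteSpace X]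
    {Y : Type v} [NormedAddCommGroup Y] [NormedSpace 𝕜 Y] [CompleteSpace Y]
    (k : ℕ) (hk : 1 ≤ k) (P : X → Y) (hP : IsHomogeneousPolynomial 𝕜 k P) :
    List.TFAE [
      -- (A)
      ∀ x : ℕ → X, IsWUC 𝕜 x →
        (∀ a : ℕ → CZero 𝕜, Bornology.IsBounded (Set.range a) →
          IsRelWeaklyCompact 𝕜 (imageSet P x a)) →
        IsUC x,
      -- (B)
      ∀ x : ℕ → X, IsWUC 𝕜 x →
        (∀ a : ℕ → CZero 𝕜, Bornology.IsBounded (Set.range a) →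
          IsRelCompact (imageSet P x a)) →
        IsUC x,
      -- (C)
      ∀ x : ℕ → X, IsEquivalentToCZeroBasis 𝕜 x →
        ∃ a : ℕ → CZero 𝕜, Bornology.IsBounded (Set.range a) ∧
          ¬ IsRelWeaklyCompact 𝕜 (imageSet P x a),
      -- (D)
      ∀ x : ℕ → X, IsEquivalentToCZeroBasis 𝕜 x →
        ∃ a : ℕ → CZero 𝕜, Bornology.IsBounded (Set.range a) ∧
          ¬ IsRelCompact (imageSet P x a),
      -- (E)
      ∀ (Z : Type w) [NormedAddCommGroup Z] [NormedSpace 𝕜 Z] [CompleteSpace Z] (T : Z →L[𝕜] X),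
        IsUnconditionallyConverging 𝕜 (P ∘ T) → IsUnconditionallyConverging 𝕜 T,
      -- (F)
      ∀ T : CZero 𝕜 →L[𝕜] X, IsCompactPolynomial (P ∘ T) → IsCompactOperator T,
      -- (G)
      ∀ M : Submodule 𝕜 X, IsClosed (M : Set X) → ContainsCZero 𝕜 M →
        ¬ IsUnconditionallyConverging 𝕜 (P ∘ M.subtypeL),
      -- (H)
      ∀ M : Submodule 𝕜 X, IsClosed (M : Set X) → IsIsomorphicToCZero 𝕜 M →
        ¬ IsCompactPolynomial (P ∘ M.subtypeL)] := by
  rw [← not_isCompactOnCopyOfCZero_iff hP]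
  tfae_have 1 → 2 := fun hA x hx h ↦ hA x hx fun a ha ↦ (h a ha).isRelWeaklyCompact
  tfae_have 1 → 3 := exists_not_of_forall_isUC
  tfae_have 2 → 4 := fun hB ↦ (not_isCompactOnCopyOfCZero_iff hP).2 (exists_not_of_forall_isUC hB)
  tfae_have 3 → 4 := fun hC ↦ (not_isCompactOnCopyOfCZero_iff hP).2 fun x hx ↦
    (hC x hx).imp fun _ ↦ And.imp_right (mt IsRelCompact.isRelWeaklyCompact)
  tfae_have 4 → 1 := fun hD x hx ↦ isUC_of_forall_isRelWeaklyCompact_imageSet hP hD hx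
  tfae_have 4 → 5 := fun hD _ _ _ _ ↦ isUnconditionallyConverging_of_comp hP hD
  tfae_have 5 → 4 := fun hE ⟨T, hT, hPT⟩ ↦ not_isUnconditionallyConverging_of_antilipschitz hT <|
    isUnconditionallyConverging_of_forall_universe hE T
      ((hP.comp T).isUnconditionallyConverging_of_isCompactPolynomial hPT)
  tfae_have 4 → 6 := isCompactOperator_of_isCompactPolynomial_comp hP
  tfae_have 6 → 4 := fun hF ⟨T, hT, hPT⟩ ↦ not_isCompactOperator_of_antilipschitz hT (hF T hPT)
  tfae_have 4 → 7 := fun hD _ _ hM hPM ↦ hD (isCompactOnCopyOfCZero_of_containsCZero hP hM hPM)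
  tfae_have 7 → 8 := fun hG M hM hMc hPM ↦ hG M hM hMc.containsCZero
    ((hP.comp M.subtypeL).isUnconditionallyConverging_of_isCompactPolynomial hPM)
  tfae_have 8 → 4 := fun hH hc ↦
    have ⟨M, hM, hMc, hPM⟩ := hc.exists_submodule hP
    hH M hM hMc hPM
  tfae_finish
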